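/- Let $n\ge 0$ and $a\in\mathbb C$, let $\wp$ be the Weierstrass function of a lattice $\Lambda\subset\mathbb C$, and let $\lambda_1,\dots,\lambda_n\in\mathbb C$ satisfy $\lambda_i-\lambda_j\notin\Lambda$ for $i\ne j$. Write $x_{ij}=x_i-x_j$ and $\lambda_{ij}=\lambda_i-\lambda_j$, where $x_1,\dots,x_n$ are the coordinates on $\mathbb C^n$, and let $\mathcal M$ be the algebra of meromorphic functions on $\mathbb C^n$. Put $\psi_{ij}(z)=\frac{a^2}{z^2}-(\wp(z)-\wp(\lambda_{ij}))$. Let $\tilde{\mathcal E}_n(\psi_{ij})$ be the $\mathbb C$-algebra generated by the algebra $\mathcal M$ and symbols $\langle ij\rangle=-\langle ji\rangle$ ($1\le i,j\le n$, $i\neq j$), subject to the relations (i) $\langle ij\rangle^2=\psi_{ij}(x_{ij})$; (ii) $\langle ij\rangle\langle kl\rangle=\langle kl\rangle\langle ij\rangle$ if $\{i,j\}\cap\{k,l\}=\emptyset$; (iii) $\langle ij\rangle\langle jk\rangle+\langle jk\rangle\langle ki\rangle+\langle ki\rangle\langle ij\rangle=0$ for distinct $i,j,k$; (iv) $\bigl(\langle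 ij\rangle-\frac{a}{x_{ij}}\bigr)f(\xi)=f(s_{ij}\xi)\bigl(\langle ij\rangle-\frac{a}{x_{ij}}\bigr)$ for $f\in\mathcal M$, where $s_{ij}$ exchanges the $i$-th and $j$-th coordinates of $\xi\in\mathbb C^n$. Put $[ij]=\langle ij\rangle-\frac{a}{x_{ij}}$, and let $\theta_i=\sum_{j\ne i}[ij]$ be the Dunkl elements; they commute pairwise. The deformed elementary symmetric polynomials $E_k(I)=E_k(X_i\mid i\in I)$, $I\subset\{1,\dots,n\}$, in commuting variables $X_i$ are defined by $E_0(I)=1$, $E_k(I)=0$ for $k<0$, $E_k(\emptyset)=0$ for $k>0$, and $$E_k(I\cup\{j\})=E_k(I)+E_{k-1}(I)X_j+\sum_{i\in I}\wp(\lambda_{ij})E_{k-2}(I\setminus\{i\})\qquad(j\notin I).$$ For $I_0\subset\{1,\dots,n\}$ of even cardinality let $\phi(I_0)=\sum\prod_{(c,d)}\wp(x_{cd})\in\mathcal M$, where the sum is over all perfect matchings of $I_0$, i.e. all partitions of $I_0$ into pairs, and the product is over the pairs $(c,d)$, $c<d$, of the matching (so $\phi(\emptyset)=1$). Then for every integer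 $k\ge0$ one has in $\tilde{\mathcal E}_n(\psi_{ij})$ $$E_k(\theta_1,\dots,\theta_n)=\begin{cases}\displaystyle\sum_{I_0\subset\{1,\dots,n\},\ \#I_0=k}\phi(I_0)&\text{if }k\text{ is even},\\[2mm] 0&\text{if }k\text{ is odd}.\end{cases}$$ -/

import Mathlib

open Filter Topology

noncomputable section

namespace EllipticFK

/-! ### Meromorphic functions on a complex vector space -/

/-- The filter of sets that contain a dense open set. -/
def denseOpen (E : Type*) [TopologicalSpace E] : Filter E where
  sets := {s | Dense (interior s)}
  univ_sets := by simp
  sets_of_superset := fun hs hst => hs.mono (interior_mono hst)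
  inter_sets := fun {s t} hs ht => by
    simp only [Set.mem_ofPred_eq, interior_inter] at *
    exact hs.inter_of_isOpen_left ht isOpen_interior

section Meromorphic

variable {E : Type*} [NormedAddCommGroup E] [NormedSpace ℂ E]

/-- `f` is locally a quotient `p / q` of holomorphic functions, where `q` does not vanish
identically on any nonempty open subset of a neighbourhood of the point. The values of `f` are only
constrained generically, that is, on a dense open subset of a neighbourhood of the point. -/
def IsMero (f : E → ℂ) : Prop :=
  ∀ z : E, ∃ p q : E → ℂ, AnalyticAt ℂ p z ∧ AnalyticAt ℂ q z ∧
    (∀ᶠ w in 𝓝 z ⊓ denseOpen E, q w ≠ 0) ∧ ∀ᶠ w in 𝓝 z ⊓ denseOpen E, q w * f w = p w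

lemma IsMero.add {f g : E → ℂ} (hf : IsMero f) (hg : IsMero g) : IsMero (f + g) := by
  intro z
  obtain ⟨p, q, hp, hq, h0, h⟩ := hf z
  obtain ⟨p', q', hp', hq', h0', h'⟩ := hg z
  refine ⟨fun w => p w * q' w + p' w * q w, fun w => q w * q' w, by fun_prop, by fun_prop,
    ?_, ?_⟩
  · filter_upwards [h0, h0'] with w a b using mul_ne_zero a b
  · filter_upwards [h, h'] with w a b
    rw [← a, ← b, Pi.add_apply]; ring

lemma IsMero.mul {f g : E → ℂ} (hf : IsMero f) (hg : IsMero g) : IsMero (f * g) := by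
  intro z
  obtain ⟨p, q, hp, hq, h0, h⟩ := hf z
  obtain ⟨p', q', hp', hq', h0', h'⟩ := hg z
  refine ⟨fun w => p w * p' w, fun w => q w * q' w, by fun_prop, by fun_prop, ?_, ?_⟩
  · filter_upwards [h0, h0'] with w a b using mul_ne_zero a b
  · filter_upwards [h, h'] with w a b
    rw [← a, ← b, Pi.mul_apply]; ring

lemma isMero_const (c : ℂ) : IsMero (fun _ : E => c) := fun z =>
  ⟨fun _ => c, fun _ => 1, by fun_prop, by fun_prop, by simp, by simp⟩

variable (E) in
/-- The algebra of all functions that represent a meromorphic function on `E`. -/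
def meroFun : Subalgebra ℂ (E → ℂ) where
  carrier := {f | IsMero f}
  mul_mem' := IsMero.mul
  add_mem' := IsMero.add
  algebraMap_mem' := fun c => isMero_const c

variable (E) in
/-- The ideal of representatives that vanish on a dense open set. -/
def negligible : Ideal (meroFun E) where
  carrier := {f | ∀ᶠ w in denseOpen E, f.1 w = 0}
  zero_mem' := by simp
  add_mem' := fun {f g} hf hg => by
    simp only [Set.mem_ofPred_eq] at *
    filter_upwards [hf, hg] with w a b
    simp [a, b]
  smul_mem' := fun c f hf => by
    simp only [Set.mem_ofPred_eq] at *
    filter_upwards [hf] with w a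
    simp [a]

variable (E) in
/-- The algebra of meromorphic functions on `E`: representatives are identified when they agree on
a dense open set, so the values at poles and at points of indeterminacy are irrelevant. -/
def Mero : Type _ := meroFun E ⧸ negligible E

instance : CommRing (Mero E) := inferInstanceAs (CommRing (meroFun E ⧸ negligible E))

instance : Algebra ℂ (Mero E) := inferInstanceAs (Algebra ℂ (meroFun E ⧸ negligible E))

/-- The meromorphic function represented by `f`. -/
def Mero.mk (f : E → ℂ) (hf : IsMero f) : Mero E := Ideal.Quotient.mk (negligible E) ⟨f, hf⟩

lemma Mero.mk_eq_mk_iff {f g : E → ℂ} (hf : IsMero f) (hg : IsMero g) :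
    Mero.mk f hf = Mero.mk g hg ↔ ∀ᶠ w in denseOpen E, f w = g w := by
  refine (Ideal.Quotient.mk_eq_mk_iff_sub_mem (I := negligible E) _ _).trans ?_
  change (∀ᶠ w in denseOpen E, f w - g w = 0) ↔ _
  simp only [sub_eq_zero]

/-! ### Pulling back meromorphic functions -/

variable {F : Type*} [NormedAddCommGroup F] [NormedSpace ℂ F]

lemma tendsto_denseOpen {X Y : Type*} [TopologicalSpace X] [TopologicalSpace Y] {e : X → Y}
    (hc : Continuous e) (ho : IsOpenMap e) : Tendsto e (denseOpen X) (denseOpen Y) := by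
  intro s hs
  exact (Dense.preimage hs ho).mono (preimage_interior_subset_interior_preimage hc)

lemma IsMero.comp {f : F → ℂ} (hf : IsMero f) (e : E →L[ℂ] F) (ho : IsOpenMap e) :
    IsMero (f ∘ e) := by
  intro z
  obtain ⟨p, q, hp, hq, h0, h⟩ := hf (e z)
  have ht : Tendsto e (𝓝 z ⊓ denseOpen E) (𝓝 (e z) ⊓ denseOpen F) :=
    (e.continuous.tendsto z).inf (tendsto_denseOpen e.continuous ho)
  exact ⟨p ∘ e, q ∘ e, hp.comp (e.analyticAt z), hq.comp (e.analyticAt z),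
    ht.eventually h0, ht.eventually h⟩

/-- The substitution `f ↦ f ∘ e` on meromorphic functions, for a linear automorphism `e`. -/
def Mero.comp (e : E ≃L[ℂ] E) : Mero E →ₐ[ℂ] Mero E :=
  Ideal.quotientMapₐ (negligible E)
    ({ toFun := fun f => ⟨f.1 ∘ e, f.2.comp (e : E →L[ℂ] E) e.toHomeomorph.isOpenMap⟩
       map_one' := rfl
       map_mul' := fun _ _ => rfl
       map_zero' := rfl
       map_add' := fun _ _ => rfl
       commutes' := fun _ => rfl } : meroFun E →ₐ[ℂ] meroFun E)
    (fun _ hf => (tendsto_denseOpen e.continuous e.toHomeomorph.isOpenMap).eventually hf)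

lemma Mero.comp_mk (e : E ≃L[ℂ] E) (f : E → ℂ) (hf : IsMero f) :
    Mero.comp e (Mero.mk f hf) =
      Mero.mk (f ∘ e) (hf.comp (e : E →L[ℂ] E) e.toHomeomorph.isOpenMap) := rfl

end Meromorphic

lemma isMero_of_meromorphic {f : ℂ → ℂ} (hf : Meromorphic f) : IsMero f := by
  intro c
  obtain ⟨m, hm⟩ := hf c
  refine ⟨fun w => (w - c) ^ m • f w, fun w => (w - c) ^ m, hm, by fun_prop, ?_, ?_⟩
  · have : ∀ᶠ w in denseOpen ℂ, w ≠ c := by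
      change Dense (interior ({c}ᶜ : Set ℂ))
      rw [isOpen_compl_singleton.interior_eq]
      exact dense_compl_singleton c
    filter_upwards [this.filter_mono inf_le_right] with w hw
    exact pow_ne_zero _ (sub_ne_zero.2 hw)
  · simp

/-! ### The space `ℂⁿ` with coordinates `x₁, …, xₙ` -/

section Coordinates

variable {n : ℕ}

/-- The linear form `xᵢ - xⱼ`. -/
def diffForm (i j : Fin n) : (Fin n → ℂ) →L[ℂ] ℂ :=
  (ContinuousLinearMap.proj i : (Fin n → ℂ) →L[ℂ] ℂ) -
    (ContinuousLinearMap.proj j : (Fin n → ℂ) →L[ℂ] ℂ)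

lemma isMero_diff {f : ℂ → ℂ} (hf : Meromorphic f) (i j : Fin n) :
    IsMero (fun x : Fin n → ℂ => f (x i - x j)) := by
  rcases eq_or_ne i j with rfl | hij
  · simpa using isMero_const (f 0)
  · refine (isMero_of_meromorphic hf).comp (diffForm i j) ?_
    refine ContinuousLinearMap.isOpenMap _ fun c => ⟨Pi.single i c, ?_⟩
    simp [diffForm, hij.symm]

/-- The meromorphic function `f(xᵢ - xⱼ)` on `ℂⁿ`, for a meromorphic function `f` on `ℂ`. -/
def ofDiff (f : {f : ℂ → ℂ // Meromorphic f}) (i j : Fin n) : Mero (Fin n → ℂ) :=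
  Mero.mk (fun x => f.1 (x i - x j)) (isMero_diff f.2 i j)

/-- The transposition `s_{ij}` acting on `ℂⁿ` by exchanging the `i`-th and `j`-th coordinates. -/
def swapCoord (i j : Fin n) : (Fin n → ℂ) ≃L[ℂ] (Fin n → ℂ) :=
  ContinuousLinearEquiv.piCongrLeft ℂ (fun _ : Fin n => ℂ) (Equiv.swap i j)

lemma swapCoord_apply (i j k : Fin n) (x : Fin n → ℂ) :
    swapCoord i j x k = x (Equiv.swap i j k) := by
  obtain ⟨l, rfl⟩ := (Equiv.swap i j).surjective k
  rw [Equiv.swap_apply_self]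
  exact Equiv.piCongrLeft_apply_apply (fun _ : Fin n => ℂ) (Equiv.swap i j) x l

end Coordinates

/-! ### The deformed Fomin-Kirillov algebra -/

/-- Generators of the algebra: the symbols `⟨ij⟩` and the meromorphic functions on `ℂⁿ`. -/
inductive Gen (n : ℕ) : Type
  | bracket (i j : Fin n) : Gen n
  | fn (f : Mero (Fin n → ℂ)) : Gen n

section Algebra

variable {n : ℕ}

/-- The symbol `⟨ij⟩` in the free algebra. -/
def preBracket (i j : Fin n) : FreeAlgebra ℂ (Gen n) := FreeAlgebra.ι ℂ (Gen.bracket i j)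

/-- A meromorphic function as an element of the free algebra. -/
def preFn (f : Mero (Fin n → ℂ)) : FreeAlgebra ℂ (Gen n) := FreeAlgebra.ι ℂ (Gen.fn f)

/-- The defining relations. The first three say that meromorphic functions are added, multiplied
and identified with constants inside the algebra as usual; `antisymm` is the convention that the
symbols are indexed by roots, `[-α] = -[α]` (it also gives `⟨ii⟩ = 0`, so that only the symbols
with `i ≠ j` matter). -/
inductive Rel (φ ψ : Fin n → Fin n → {f : ℂ → ℂ // Meromorphic f}) :
    FreeAlgebra ℂ (Gen n) → FreeAlgebra ℂ (Gen n) → Prop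
  | fn_add (f g : Mero (Fin n → ℂ)) : Rel φ ψ (preFn (f + g)) (preFn f + preFn g)
  | fn_mul (f g : Mero (Fin n → ℂ)) : Rel φ ψ (preFn (f * g)) (preFn f * preFn g)
  | fn_const (c : ℂ) : Rel φ ψ (preFn (algebraMap ℂ _ c)) (algebraMap ℂ _ c)
  | antisymm (i j : Fin n) : Rel φ ψ (preBracket i j) (-preBracket j i)
  | square (i j : Fin n) (hij : i ≠ j) :
      Rel φ ψ (preBracket i j * preBracket i j) (preFn (ofDiff (ψ i j) i j))
  | commute (i j k l : Fin n) (hij : i ≠ j) (hkl : k ≠ l)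
      (hik : i ≠ k) (hil : i ≠ l) (hjk : j ≠ k) (hjl : j ≠ l) :
      Rel φ ψ (preBracket i j * preBracket k l) (preBracket k l * preBracket i j)
  | threeTerm (i j k : Fin n) (hij : i ≠ j) (hjk : j ≠ k) (hki : k ≠ i) :
      Rel φ ψ (preBracket i j * preBracket j k + preBracket j k * preBracket k i
        + preBracket k i * preBracket i j) 0
  | cross (i j : Fin n) (hij : i ≠ j) (f : Mero (Fin n → ℂ)) :
      Rel φ ψ ((preBracket i j - preFn (ofDiff (φ i j) i j)) * preFn f)
        (preFn (Mero.comp (swapCoord i j) f) * (preBracket i j - preFn (ofDiff (φ i j) i j)))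

/-- The quadratic algebra `Ẽₙ(φᵢⱼ, ψᵢⱼ)`. -/
def QuadAlg (φ ψ : Fin n → Fin n → {f : ℂ → ℂ // Meromorphic f}) : Type := RingQuot (Rel φ ψ)

instance (φ ψ : Fin n → Fin n → {f : ℂ → ℂ // Meromorphic f}) : Ring (QuadAlg φ ψ) :=
  inferInstanceAs (Ring (RingQuot (Rel φ ψ)))

instance (φ ψ : Fin n → Fin n → {f : ℂ → ℂ // Meromorphic f}) : Algebra ℂ (QuadAlg φ ψ) :=
  inferInstanceAs (Algebra ℂ (RingQuot (Rel φ ψ)))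

/-- The quotient map from the free algebra. -/
def toQuadAlg (φ ψ : Fin n → Fin n → {f : ℂ → ℂ // Meromorphic f}) :
    FreeAlgebra ℂ (Gen n) →ₐ[ℂ] QuadAlg φ ψ := RingQuot.mkAlgHom ℂ (Rel φ ψ)

lemma toQuadAlg_rel {φ ψ : Fin n → Fin n → {f : ℂ → ℂ // Meromorphic f}}
    {x y : FreeAlgebra ℂ (Gen n)} (h : Rel φ ψ x y) : toQuadAlg φ ψ x = toQuadAlg φ ψ y :=
  RingQuot.mkAlgHom_rel ℂ h

variable (φ ψ : Fin n → Fin n → {f : ℂ → ℂ // Meromorphic f})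

/-- The generator `⟨ij⟩` of the algebra. -/
def angle (i j : Fin n) : QuadAlg φ ψ := toQuadAlg φ ψ (preBracket i j)

/-- A meromorphic function as an element of the algebra. -/
def scalar : Mero (Fin n → ℂ) →ₐ[ℂ] QuadAlg φ ψ :=
  AlgHom.ofLinearMap
    { toFun := fun f => toQuadAlg φ ψ (preFn f)
      map_add' := fun f g => by
        rw [toQuadAlg_rel (Rel.fn_add (φ := φ) (ψ := ψ) f g), map_add]
      map_smul' := fun c f => by
        rw [Algebra.smul_def, toQuadAlg_rel (Rel.fn_mul (φ := φ) (ψ := ψ) _ f), map_mul,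
          toQuadAlg_rel (Rel.fn_const (φ := φ) (ψ := ψ) c), AlgHom.commutes,
          RingHom.id_apply, Algebra.smul_def] }
    (by
      change toQuadAlg φ ψ (preFn 1) = 1
      rw [← map_one (algebraMap ℂ (Mero (Fin n → ℂ))),
        toQuadAlg_rel (Rel.fn_const (φ := φ) (ψ := ψ) 1), map_one, map_one])
    (fun f g => by
      change toQuadAlg φ ψ (preFn (f * g)) = _
      rw [toQuadAlg_rel (Rel.fn_mul (φ := φ) (ψ := ψ) f g), map_mul]; rfl)

/-- The element `[ij] = ⟨ij⟩ - φᵢⱼ(xᵢ - xⱼ)`, for `i ≠ j`. -/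
def bracket (i j : Fin n) : QuadAlg φ ψ := angle φ ψ i j - scalar φ ψ (ofDiff (φ i j) i j)

/-- The Dunkl element `θᵢ = ∑_{j ≠ i} [ij]`. -/
def dunkl (i : Fin n) : QuadAlg φ ψ := ∑ j ∈ Finset.univ.erase i, bracket φ ψ i j

end Algebra

/-! ### The elliptic case -/

section Elliptic

/-- The Weierstrass function as a meromorphic function on `ℂ`. -/
def wp (L : PeriodPair) : {f : ℂ → ℂ // Meromorphic f} := ⟨L.weierstrassP, L.meromorphic_weierstrassP⟩

/-- The function `φᵢⱼ(z) = a / z`. -/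
def ratPhi (n : ℕ) (a : ℂ) : Fin n → Fin n → {f : ℂ → ℂ // Meromorphic f} := fun _ _ =>
  ⟨fun z => a / z, fun z => by fun_prop⟩

/-- The function `ψᵢⱼ(z) = a² / z² - (℘(z) - ℘(λᵢ - λⱼ))`. -/
def ellPsi {n : ℕ} (L : PeriodPair) (lam : Fin n → ℂ) (a : ℂ) :
    Fin n → Fin n → {f : ℂ → ℂ // Meromorphic f} := fun i j =>
  ⟨fun z => a ^ 2 / z ^ 2 - (L.weierstrassP z - L.weierstrassP (lam i - lam j)), fun z => by
    have := L.meromorphic_weierstrassP z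
    fun_prop⟩

/-- `M` is a perfect matching of `I`: a set of pairs `(a, b)` with `a < b` and `a, b ∈ I` such that
every element of `I` belongs to exactly one of the pairs. -/
def IsPerfectMatching {n : ℕ} (I : Finset (Fin n)) (M : Finset (Fin n × Fin n)) : Prop :=
  (∀ p ∈ M, p.1 < p.2 ∧ p.1 ∈ I ∧ p.2 ∈ I) ∧ ∀ i ∈ I, ∃! p, p ∈ M ∧ (p.1 = i ∨ p.2 = i)

open Classical in
/-- `φ(I) = ∑ ∏ ℘(x_a - x_b)`, the sum over the perfect matchings of `I`, the product over the
pairs `(a, b)` of the matching. -/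
def matchSum {n : ℕ} (L : PeriodPair) (I : Finset (Fin n)) : Mero (Fin n → ℂ) :=
  ∑ M with IsPerfectMatching I M, ∏ p ∈ M, ofDiff (wp L) p.1 p.2

end Elliptic

/-! ### Deformed elementary symmetric polynomials -/

section Deformed

variable {ι R : Type*} [LinearOrder ι] [Ring R] [Algebra ℂ R]

/-- The deformed elementary symmetric polynomial `E_k(X_i | i ∈ I)` with deformation parameters
`c i j`, evaluated at elements `X i` of an algebra, by the recursion
`E_k(I ∪ {j}) = E_k(I) + E_{k-1}(I) X_j + ∑_{i ∈ I} c i j • E_{k-2}(I \ {i})`, where `E₀ = 1`,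
`E_k = 0` for `k < 0` and `E_k(∅) = 0` for `k > 0`. Here `j` is the largest element of `I ∪ {j}`;
`defE_insert` shows that the recursion then holds for every `j`, if the `X i` commute, as the Dunkl
elements do by `dunkl_commute`. -/
def defE (c : ι → ι → ℂ) (X : ι → R) : ℕ → Finset ι → R
  | 0, _ => 1
  | 1, I =>
    if h : I.Nonempty then
      defE c X 1 (I.erase (I.max' h)) + defE c X 0 (I.erase (I.max' h)) * X (I.max' h)
    else 0
  | k + 2, I =>
    if h : I.Nonempty then
      defE c X (k + 2) (I.erase (I.max' h)) + defE c X (k + 1) (I.erase (I.max' h)) * X (I.max' h)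
        + ∑ i ∈ I.erase (I.max' h), c i (I.max' h) • defE c X k ((I.erase (I.max' h)).erase i)
    else 0
  termination_by _ I => I.card
  decreasing_by
    all_goals
      have := Finset.card_erase_lt_of_mem (I.max'_mem h)
      first
        | exact this
        | exact lt_of_le_of_lt (Finset.card_le_card (Finset.erase_subset _ _)) this

variable (c : ι → ι → ℂ) (X : ι → R)

/-- `E_k` for an integer `k`, with `E_k = 0` for `k < 0`. -/
def defEInt (k : ℤ) (I : Finset ι) : R := if k < 0 then 0 else defE c X k.toNat I

lemma defEInt_max (k : ℤ) (I : Finset ι) (h : I.Nonempty) :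
    defEInt c X k I = defEInt c X k (I.erase (I.max' h)) +
      defEInt c X (k - 1) (I.erase (I.max' h)) * X (I.max' h) +
      ∑ i ∈ I.erase (I.max' h),
        c i (I.max' h) • defEInt c X (k - 2) ((I.erase (I.max' h)).erase i) := by
  rcases lt_or_ge k 0 with hk | hk
  · simp [defEInt, hk, show k - 1 < 0 by omega, show k - 2 < 0 by omega]
  · lift k to ℕ using hk
    match k with
    | 0 => simp [defEInt, defE]
    | 1 =>
      have this := defE.eq_def c X 1 I
      simp only [dif_pos h] at this
      simpa [defEInt] using this
    | k + 2 =>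
      have this := defE.eq_def c X (k + 2) I
      simp only [dif_pos h] at this
      have h1 : ((k : ℤ) + 2 - 1) = ((k + 1 : ℕ) : ℤ) := by push_cast; ring
      have h2 : ((k : ℤ) + 2 - 2) = (k : ℤ) := by ring
      have h3 : ((k : ℤ) + 2) = ((k + 2 : ℕ) : ℤ) := by push_cast; ring
      have hz : ∀ m : ℕ, ¬ (m : ℤ) < 0 := fun m => by omega
      push_cast
      rw [h1, h2, h3]
      simpa only [defEInt, if_neg (hz _), Int.toNat_natCast] using this

variable {c X}

lemma defEInt_erase (hc : ∀ i j, c i j = c j i) (hX : ∀ i j, Commute (X i) (X j)) (N : ℕ) :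
    ∀ (I : Finset ι), I.card = N → ∀ (k : ℤ) (j : ι), j ∈ I →
      defEInt c X k I = defEInt c X k (I.erase j) + defEInt c X (k - 1) (I.erase j) * X j +
        ∑ i ∈ I.erase j, c i j • defEInt c X (k - 2) ((I.erase j).erase i) := by
  induction N using Nat.strong_induction_on with
  | _ N ih =>
  intro I hI k j hj
  have hne : I.Nonempty := ⟨j, hj⟩
  obtain ⟨m, hm⟩ : ∃ m, m = I.max' hne := ⟨_, rfl⟩
  have hmax := fun k => defEInt_max c X k I hne
  rw [← hm] at hmax
  have hmI : m ∈ I := hm ▸ I.max'_mem hne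
  rcases eq_or_ne j m with rfl | hjm
  · exact hmax k
  -- expansion at an element `l` of a proper subset
  have key : ∀ (J : Finset ι), J ⊂ I → ∀ (k : ℤ) (l : ι), l ∈ J →
      defEInt c X k J = defEInt c X k (J.erase l) + defEInt c X (k - 1) (J.erase l) * X l +
        ∑ i ∈ J.erase l, c i l • defEInt c X (k - 2) ((J.erase l).erase i) :=
    fun J hJ => ih J.card (hI ▸ Finset.card_lt_card hJ) J rfl
  -- the expansion at `l₁`, then at `l₂`
  have two : ∀ (l₁ l₂ : ι), l₁ ∈ I → l₂ ∈ I → l₂ ≠ l₁ →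
      defEInt c X k (I.erase l₁) + defEInt c X (k - 1) (I.erase l₁) * X l₁ +
        ∑ i ∈ I.erase l₁, c i l₁ • defEInt c X (k - 2) ((I.erase l₁).erase i) =
      defEInt c X k ((I.erase l₁).erase l₂) +
      (defEInt c X (k - 1) ((I.erase l₁).erase l₂) * X l₂ +
        defEInt c X (k - 1) ((I.erase l₁).erase l₂) * X l₁) +
      defEInt c X (k - 2) ((I.erase l₁).erase l₂) * (X l₂ * X l₁) +
      ((∑ i ∈ (I.erase l₁).erase l₂,
        c i l₂ • defEInt c X (k - 2) (((I.erase l₁).erase l₂).erase i)) +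
       (∑ i ∈ (I.erase l₁).erase l₂,
        c i l₁ • defEInt c X (k - 2) (((I.erase l₁).erase l₂).erase i))) +
      ((∑ i ∈ (I.erase l₁).erase l₂,
        c i l₂ • defEInt c X (k - 3) (((I.erase l₁).erase l₂).erase i) * X l₁) +
       (∑ i ∈ (I.erase l₁).erase l₂,
        c i l₁ • defEInt c X (k - 3) (((I.erase l₁).erase l₂).erase i) * X l₂)) +
      c l₂ l₁ • defEInt c X (k - 2) ((I.erase l₁).erase l₂) +
      ∑ i ∈ (I.erase l₁).erase l₂, ∑ l ∈ ((I.erase l₁).erase l₂).erase i,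
        (c i l₁ * c l l₂) •
          defEInt c X (k - 4) ((((I.erase l₁).erase l₂).erase i).erase l) := by
    intro l₁ l₂ h₁ h₂ h₁₂
    have hl₂ : l₂ ∈ I.erase l₁ := Finset.mem_erase.2 ⟨h₁₂, h₂⟩
    have hs := Finset.erase_ssubset h₁
    rw [key _ hs k l₂ hl₂, key _ hs (k - 1) l₂ hl₂, ← Finset.add_sum_erase _ _ hl₂]
    have inner : ∀ i ∈ (I.erase l₁).erase l₂,
        c i l₁ • defEInt c X (k - 2) ((I.erase l₁).erase i) =
        c i l₁ • defEInt c X (k - 2) (((I.erase l₁).erase l₂).erase i) +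
        c i l₁ • defEInt c X (k - 3) (((I.erase l₁).erase l₂).erase i) * X l₂ +
        ∑ l ∈ ((I.erase l₁).erase l₂).erase i, (c i l₁ * c l l₂) •
          defEInt c X (k - 4) ((((I.erase l₁).erase l₂).erase i).erase l) := by
      intro i hi
      have hl₂i : l₂ ∈ (I.erase l₁).erase i :=
        Finset.mem_erase.2 ⟨(Finset.mem_erase.1 hi).1.symm, hl₂⟩
      rw [key _ ((Finset.erase_subset _ _).trans_ssubset hs) (k - 2) l₂ hl₂i,
        Finset.erase_right_comm (a := i) (b := l₂), smul_add, smul_add, Finset.smul_sum,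
        show k - 2 - 1 = k - 3 by ring, show k - 2 - 2 = k - 4 by ring]
      simp only [smul_smul, smul_mul_assoc]
    rw [Finset.sum_congr rfl inner, Finset.sum_add_distrib, Finset.sum_add_distrib,
      show k - 1 - 1 = k - 2 by ring, show k - 1 - 2 = k - 3 by ring, add_mul, add_mul,
      Finset.sum_mul, mul_assoc]
    abel
  rw [hmax, two m j hmI hj hjm, two j m hj hmI hjm.symm, Finset.erase_right_comm (a := m) (b := j),
    (hX j m).eq, hc j m]
  have e1 := add_comm (defEInt c X (k - 1) ((I.erase j).erase m) * X j)
    (defEInt c X (k - 1) ((I.erase j).erase m) * X m)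
  have e2 : ∑ i ∈ (I.erase j).erase m, ∑ l ∈ ((I.erase j).erase m).erase i,
        (c i m * c l j) • defEInt c X (k - 4) ((((I.erase j).erase m).erase i).erase l) =
      ∑ i ∈ (I.erase j).erase m, ∑ l ∈ ((I.erase j).erase m).erase i,
        (c i j * c l m) • defEInt c X (k - 4) ((((I.erase j).erase m).erase i).erase l) := by
    rw [Finset.sum_comm' (t' := (I.erase j).erase m) (s' := fun l => ((I.erase j).erase m).erase l)
      (by intro x y; simp only [Finset.mem_erase]; tauto)]
    refine Finset.sum_congr rfl fun i _ => Finset.sum_congr rfl fun l _ => ?_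
    rw [mul_comm, Finset.erase_right_comm]
  rw [e2, e1]
  abel

/-- The recursion that defines the polynomials `E_k` holds for every `j`, when the elements `X i`
commute and the parameters are symmetric. -/
lemma defE_insert (hc : ∀ i j, c i j = c j i) (hX : ∀ i j, Commute (X i) (X j)) (k : ℕ)
    (I : Finset ι) (j : ι) (hj : j ∉ I) :
    defE c X (k + 2) (insert j I) = defE c X (k + 2) I + defE c X (k + 1) I * X j +
      ∑ i ∈ I, c i j • defE c X k (I.erase i) := by
  have := defEInt_erase hc hX _ (insert j I) rfl (k + 2 : ℕ) j (Finset.mem_insert_self j I)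
  have h1 : (((k + 2 : ℕ) : ℤ) - 1) = ((k + 1 : ℕ) : ℤ) := by push_cast; ring
  have h2 : (((k + 2 : ℕ) : ℤ) - 2) = (k : ℤ) := by push_cast; ring
  have hz : ∀ m : ℕ, ¬ (m : ℤ) < 0 := fun m => by omega
  rw [h1, h2] at this
  simpa only [defEInt, if_neg (hz _), Int.toNat_natCast, Finset.erase_insert hj] using this

lemma defE_one (I : Finset ι) : defE c X 1 I = ∑ i ∈ I, X i := by
  induction h : I.card using Nat.strong_induction_on generalizing I with
  | _ N ih =>
  subst h
  rw [defE]
  split_ifs with hI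
  · rw [ih _ (Finset.card_erase_lt_of_mem (I.max'_mem hI)) _ rfl, defE, one_mul,
      Finset.sum_erase_add _ _ (I.max'_mem hI)]
  · rw [Finset.not_nonempty_iff_eq_empty.1 hI, Finset.sum_empty]

end Deformed

/-! ### The relations between the `[ij]`, and commutativity of the Dunkl elements -/

section Commutativity

variable {n : ℕ}

lemma angle_antisymm (φ ψ : Fin n → Fin n → {f : ℂ → ℂ // Meromorphic f}) (i j : Fin n) :
    angle φ ψ i j = -angle φ ψ j i := by
  rw [angle, angle, ← map_neg, toQuadAlg_rel (Rel.antisymm (φ := φ) (ψ := ψ) i j)]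

lemma scalar_apply (φ ψ : Fin n → Fin n → {f : ℂ → ℂ // Meromorphic f}) (f : Mero (Fin n → ℂ)) :
    scalar φ ψ f = toQuadAlg φ ψ (preFn f) := rfl

lemma bracket_mul_scalar (φ ψ : Fin n → Fin n → {f : ℂ → ℂ // Meromorphic f}) {i j : Fin n}
    (hij : i ≠ j) (f : Mero (Fin n → ℂ)) :
    bracket φ ψ i j * scalar φ ψ f =
      scalar φ ψ (Mero.comp (swapCoord i j) f) * bracket φ ψ i j := by
  simp only [bracket, scalar_apply, angle, ← map_sub, ← map_mul]
  exact toQuadAlg_rel (Rel.cross i j hij f)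

lemma comp_ofDiff (f : {f : ℂ → ℂ // Meromorphic f}) (i j k l : Fin n) :
    Mero.comp (swapCoord i j) (ofDiff f k l) =
      ofDiff f (Equiv.swap i j k) (Equiv.swap i j l) := by
  rw [ofDiff, Mero.comp_mk]
  refine (Mero.mk_eq_mk_iff _ _).2 (Eventually.of_forall fun x => ?_)
  simp only [Function.comp_apply, swapCoord_apply]

variable (a : ℂ) (ψ : Fin n → Fin n → {f : ℂ → ℂ // Meromorphic f})

/-- The function `a / (xᵢ - xⱼ)` as an element of the algebra. -/
def ratFn (i j : Fin n) : QuadAlg (ratPhi n a) ψ :=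
  scalar (ratPhi n a) ψ (ofDiff (ratPhi n a i j) i j)

lemma ratFn_antisymm (i j : Fin n) : ratFn a ψ i j = -ratFn a ψ j i := by
  have h : ofDiff (ratPhi n a i j) i j = -ofDiff (ratPhi n a j i) j i := by
    refine (Mero.mk_eq_mk_iff (g := fun x : Fin n → ℂ => -(a / (x j - x i))) _
      ((meroFun (Fin n → ℂ)).neg_mem (isMero_diff (ratPhi n a j i).2 j i))).2
      (Eventually.of_forall fun x => ?_)
    change a / (x i - x j) = -(a / (x j - x i))
    rw [← div_neg, neg_sub]
  rw [ratFn, h, map_neg, ratFn]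

lemma ratFn_comm (i j k l : Fin n) :
    ratFn a ψ i j * ratFn a ψ k l = ratFn a ψ k l * ratFn a ψ i j := by
  rw [ratFn, ratFn, ← map_mul, mul_comm, map_mul]

lemma dense_ne {i j : Fin n} (hij : i ≠ j) :
    ∀ᶠ x : Fin n → ℂ in denseOpen (Fin n → ℂ), x i - x j ≠ 0 := by
  have ho : IsOpenMap (diffForm i j) := ContinuousLinearMap.isOpenMap _ fun c =>
    ⟨Pi.single i c, by simp [diffForm, hij.symm]⟩
  refine (tendsto_denseOpen (diffForm i j).continuous ho).eventually (p := fun w => w ≠ 0) ?_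
  change Dense (interior ({0}ᶜ : Set ℂ))
  rw [isOpen_compl_singleton.interior_eq]
  exact dense_compl_singleton 0

lemma ratFn_threeTerm {i j k : Fin n} (hij : i ≠ j) (hjk : j ≠ k) (hki : k ≠ i) :
    ratFn a ψ i j * ratFn a ψ j k + ratFn a ψ j k * ratFn a ψ k i
      + ratFn a ψ k i * ratFn a ψ i j = 0 := by
  have h : ofDiff (ratPhi n a i j) i j * ofDiff (ratPhi n a j k) j k +
      ofDiff (ratPhi n a j k) j k * ofDiff (ratPhi n a k i) k i +
      ofDiff (ratPhi n a k i) k i * ofDiff (ratPhi n a i j) i j = 0 := by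
    have m := fun i j => isMero_diff (ratPhi n a i j).2 i j
    refine (Mero.mk_eq_mk_iff
      ((((m i j).mul (m j k)).add ((m j k).mul (m k i))).add ((m k i).mul (m i j)))
      (isMero_const 0)).2 ?_
    filter_upwards [dense_ne hij, dense_ne hjk, dense_ne hki] with x h1 h2 h3
    change a / (x i - x j) * (a / (x j - x k)) + a / (x j - x k) * (a / (x k - x i))
      + a / (x k - x i) * (a / (x i - x j)) = 0
    field_simp
    ring
  simp only [ratFn, ← map_mul, ← map_add]
  rw [h, map_zero]

lemma bracket_mul_ratFn {i j : Fin n} (hij : i ≠ j) (k l : Fin n) :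
    bracket (ratPhi n a) ψ i j * ratFn a ψ k l =
      ratFn a ψ (Equiv.swap i j k) (Equiv.swap i j l) * bracket (ratPhi n a) ψ i j := by
  rw [ratFn, bracket_mul_scalar _ _ hij, comp_ofDiff]; rfl

lemma bracket_antisymm (i j : Fin n) :
    bracket (ratPhi n a) ψ i j = -bracket (ratPhi n a) ψ j i := by
  change angle _ _ i j - ratFn a ψ i j = -(angle _ _ j i - ratFn a ψ j i)
  rw [angle_antisymm, ratFn_antisymm]; abel

lemma angle_eq (i j : Fin n) :
    angle (ratPhi n a) ψ i j = bracket (ratPhi n a) ψ i j + ratFn a ψ i j :=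
  (sub_add_cancel _ _).symm

lemma bracket_square {i j : Fin n} (hij : i ≠ j) :
    bracket (ratPhi n a) ψ i j * bracket (ratPhi n a) ψ i j =
      scalar (ratPhi n a) ψ (ofDiff (ψ i j) i j) - ratFn a ψ i j * ratFn a ψ i j := by
  have h : angle (ratPhi n a) ψ i j * angle (ratPhi n a) ψ i j =
      scalar (ratPhi n a) ψ (ofDiff (ψ i j) i j) := by
    rw [angle, ← map_mul]
    exact toQuadAlg_rel (Rel.square i j hij)
  rw [← h, angle_eq, add_mul, mul_add, mul_add, bracket_mul_ratFn a ψ hij]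
  simp only [Equiv.swap_apply_left, Equiv.swap_apply_right]
  rw [ratFn_antisymm a ψ j i]
  noncomm_ring

lemma bracket_comm {i j k l : Fin n} (hij : i ≠ j) (hkl : k ≠ l)
    (hik : i ≠ k) (hil : i ≠ l) (hjk : j ≠ k) (hjl : j ≠ l) :
    bracket (ratPhi n a) ψ i j * bracket (ratPhi n a) ψ k l =
      bracket (ratPhi n a) ψ k l * bracket (ratPhi n a) ψ i j := by
  have h : angle (ratPhi n a) ψ i j * angle (ratPhi n a) ψ k l =
      angle (ratPhi n a) ψ k l * angle (ratPhi n a) ψ i j := by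
    rw [angle, angle, ← map_mul, ← map_mul]
    exact toQuadAlg_rel (Rel.commute i j k l hij hkl hik hil hjk hjl)
  simp only [angle_eq, add_mul, mul_add] at h
  rw [bracket_mul_ratFn a ψ hij, bracket_mul_ratFn a ψ hkl,
    Equiv.swap_apply_of_ne_of_ne hik.symm hjk.symm, Equiv.swap_apply_of_ne_of_ne hil.symm hjl.symm,
    Equiv.swap_apply_of_ne_of_ne hik hil, Equiv.swap_apply_of_ne_of_ne hjk hjl,
    ratFn_comm a ψ k l i j] at h
  have h' := sub_eq_zero.2 h
  rw [← sub_eq_zero, ← h']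
  abel

lemma bracket_threeTerm {i j k : Fin n} (hij : i ≠ j) (hjk : j ≠ k) (hki : k ≠ i) :
    bracket (ratPhi n a) ψ i j * bracket (ratPhi n a) ψ j k +
      bracket (ratPhi n a) ψ j k * bracket (ratPhi n a) ψ k i +
      bracket (ratPhi n a) ψ k i * bracket (ratPhi n a) ψ i j = 0 := by
  have h : angle (ratPhi n a) ψ i j * angle (ratPhi n a) ψ j k +
      angle (ratPhi n a) ψ j k * angle (ratPhi n a) ψ k i +
      angle (ratPhi n a) ψ k i * angle (ratPhi n a) ψ i j = 0 := by
    change toQuadAlg _ ψ _ * toQuadAlg _ ψ _ + toQuadAlg _ ψ _ * toQuadAlg _ ψ _ +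
      toQuadAlg _ ψ _ * toQuadAlg _ ψ _ = 0
    simp only [← map_mul, ← map_add]
    rw [toQuadAlg_rel (Rel.threeTerm i j k hij hjk hki), map_zero]
  simp only [angle_eq, add_mul, mul_add] at h
  rw [bracket_mul_ratFn a ψ hij, bracket_mul_ratFn a ψ hjk, bracket_mul_ratFn a ψ hki] at h
  simp only [Equiv.swap_apply_right,
    Equiv.swap_apply_of_ne_of_ne hki hjk.symm, Equiv.swap_apply_of_ne_of_ne hij hki.symm,
    Equiv.swap_apply_of_ne_of_ne hjk hij.symm] at h
  rw [ratFn_antisymm a ψ i k, ratFn_antisymm a ψ j i, ratFn_antisymm a ψ k j] at h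
  have h3 := ratFn_threeTerm a ψ hij hjk hki
  rw [← h]
  refine eq_of_sub_eq_zero ?_
  rw [← neg_eq_zero, ← h3]
  noncomm_ring

/-- The Dunkl elements commute. -/
lemma dunkl_commute (i j : Fin n) :
    Commute (dunkl (ratPhi n a) ψ i) (dunkl (ratPhi n a) ψ j) := by
  rcases eq_or_ne i j with rfl | hij
  · exact Commute.refl _
  obtain ⟨b, hb⟩ : ∃ b, b = bracket (ratPhi n a) ψ := ⟨_, rfl⟩
  have anti : ∀ i j, b i j = -b j i := fun i j => hb ▸ bracket_antisymm a ψ i j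
  have split : ∀ i j : Fin n, i ≠ j → dunkl (ratPhi n a) ψ i =
      b i j + ∑ k ∈ (Finset.univ.erase i).erase j, b i k := fun i j h => by
    rw [dunkl, hb, Finset.add_sum_erase _ _ (by simp [h.symm])]
  rw [split i j hij, split j i hij.symm, Finset.erase_right_comm (a := j)]
  obtain ⟨S, hS⟩ : ∃ S, S = (Finset.univ.erase i).erase j := ⟨_, rfl⟩
  rw [← hS]
  have hSi : ∀ k ∈ S, k ≠ i := fun k hk => by
    rw [hS] at hk; exact (Finset.mem_erase.1 (Finset.mem_erase.1 hk).2).1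
  have hSj : ∀ k ∈ S, k ≠ j := fun k hk => by
    rw [hS] at hk; exact (Finset.mem_erase.1 hk).1
  have t : ∀ k ∈ S, b i j * b j k + b j k * b k i + b k i * b i j = 0 := fun k hk =>
    hb ▸ bracket_threeTerm a ψ hij (hSj k hk).symm (hSi k hk)
  have t' : ∀ k ∈ S, b j i * b i k + b i k * b k j + b k j * b j i = 0 := fun k hk =>
    hb ▸ bracket_threeTerm a ψ hij.symm (hSi k hk).symm (hSj k hk)
  have e : (∑ k ∈ S, b i k) * (∑ k ∈ S, b j k) - (∑ k ∈ S, b j k) * (∑ k ∈ S, b i k) =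
      ∑ k ∈ S, (b i k * b j k - b j k * b i k) := by
    rw [Finset.sum_mul_sum, Finset.sum_mul_sum, Finset.sum_comm (f := fun k l => b j k * b i l),
      ← Finset.sum_sub_distrib]
    refine Finset.sum_congr rfl fun k hk => ?_
    rw [← Finset.sum_sub_distrib]
    refine Finset.sum_eq_single k (fun l hl hlk => ?_) (fun h => absurd hk h)
    rw [hb, bracket_comm a ψ (hSi k hk).symm (hSj l hl).symm hij (hSi l hl).symm (hSj k hk) hlk.symm,
      sub_self]
  have f : ∑ k ∈ S, ((b i k * b j k - b j k * b i k) + (b i j * b j k - b j k * b i j) +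
      (b i k * b j i - b j i * b i k)) = 0 := by
    refine Finset.sum_eq_zero fun k hk => ?_
    have h1 := t k hk
    have h2 := t' k hk
    rw [anti k i, anti k j, anti j i] at *
    rw [← sub_eq_zero] at h1 h2
    have h3 := congrArg₂ (· - ·) h1 h2
    simp only [sub_zero] at h3
    rw [← h3]
    noncomm_ring
  rw [Finset.sum_add_distrib, Finset.sum_add_distrib, ← e] at f
  simp only [Finset.sum_sub_distrib, ← Finset.mul_sum, ← Finset.sum_mul] at f
  rw [commute_iff_eq, ← sub_eq_zero, ← f, anti j i]
  noncomm_ring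

end Commutativity

end EllipticFK

end

namespace EllipticFK

open Finset

/-! ### Reindexing sums over subsets -/

section PowersetSums

variable {ι A : Type*} [DecidableEq ι] [AddCommMonoid A]

/-! Write b i j for [ij], c i j for ℘(λ_ij) and p i j for ℘(x_ij). In the square of b i j the terms
a²/x² cancel, so the parameter a disappears: the b i j are antisymmetric, commute for disjoint
indices, satisfy the three-term relation, and b i j ^ 2 = c i j - p i j, where c is central and p is
permuted by crossing (`bracket_isSquareDeformed`). Only these relations and the matching recursion
for φ are needed.

The formula is proved for every subset I of the variables, not only for the full set. If J
enumerates the complement of I, then E(θ_i | i ∈ I), summed over all degrees, is the sum over U ⊆ I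
of φ(U) times all products of b a l in which distinct elements a of I \ U are sent to targets l ∈ J,
the factors with a common target being taken in every order (`pieriSum`). For I full, J is empty and
only the φ(U) survive. Degrees are recovered at the end in a power series ring.

The induction on I requires `pieriSum` to satisfy the recursion defining E; this is
`pieriSum_insert`. Multiplication by 1 + θ_j turns the target j into a source (`fibreSum_mul`), up
to error terms in which a factor b a j follows a word with target j already containing it. These
errors, those with a ∈ U, and the new φ(U ∪ {j}) add up exactly to the terms with c i j
(`matching_identity`). The underlying noncommutative identity is `wordSum_mul_sum`, which rests on
`cyclicSum_add`: a word whose first letter is repeated at its end, summed over all orderings,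
collapses to the central parameters times shorter words. This deforms the cyclic relation of the
Fomin-Kirillov algebra. -/

lemma sum_powerset_compl (S : Finset ι) (f : Finset ι → Finset ι → A) :
    ∑ T ∈ S.powerset, f T (S \ T) = ∑ T ∈ S.powerset, f (S \ T) T := by
  refine sum_bij' (fun T _ => S \ T) (fun T _ => S \ T) ?_ ?_ ?_ ?_ ?_ <;>
    intro T hT <;> rw [mem_powerset] at hT
  · simp
  · simp
  · exact Finset.sdiff_sdiff_eq_self hT
  · exact Finset.sdiff_sdiff_eq_self hT
  · rw [Finset.sdiff_sdiff_eq_self hT]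

/-- A subset with a marked element is the marked element together with the rest of the subset. This
is what peels one letter off a word when the set of letters also varies. -/
lemma sum_powerset_sum_mem (S : Finset ι) (f : ι → Finset ι → Finset ι → A) :
    ∑ T ∈ S.powerset, ∑ a ∈ T, f a (T.erase a) (S \ T) =
      ∑ a ∈ S, ∑ T ∈ (S.erase a).powerset, f a T (S.erase a \ T) := by
  rw [sum_sigma', sum_sigma']
  refine sum_bij' (fun x _ => ⟨x.2, x.1.erase x.2⟩) (fun x _ => ⟨insert x.1 x.2, x.1⟩)
    ?_ ?_ ?_ ?_ ?_
  · rintro ⟨T, a⟩ h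
    simp only [mem_sigma, mem_powerset] at h ⊢
    exact ⟨h.1 h.2, erase_subset_erase _ h.1⟩
  · rintro ⟨a, T⟩ h
    simp only [mem_sigma, mem_powerset, mem_insert_self, and_true] at h ⊢
    exact insert_subset h.1 (h.2.trans (erase_subset _ _))
  · rintro ⟨T, a⟩ h
    simp only [mem_sigma] at h
    simp [insert_erase h.2]
  · rintro ⟨a, T⟩ h
    simp only [mem_sigma, mem_powerset] at h
    simp [erase_insert fun h' => notMem_erase a S (h.2 h')]
  · rintro ⟨T, a⟩ h
    simp only [mem_sigma, mem_powerset] at h ⊢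
    congr 1
    ext x
    have := h.2
    simp only [Finset.mem_sdiff, mem_erase]
    grind

/-- Both sides run over the ordered decompositions of S into three disjoint, possibly empty blocks.
-/
lemma sum_powerset_assoc (S : Finset ι) (f : Finset ι → Finset ι → Finset ι → A) :
    ∑ T ∈ S.powerset, ∑ R ∈ (S \ T).powerset, f T R ((S \ T) \ R) =
      ∑ V ∈ S.powerset, ∑ T ∈ V.powerset, f T (V \ T) (S \ V) := by
  rw [sum_sigma', sum_sigma']
  refine sum_bij' (fun x _ => ⟨x.1 ∪ x.2, x.1⟩) (fun x _ => ⟨x.2, x.1 \ x.2⟩)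
    ?_ ?_ ?_ ?_ ?_
  · rintro ⟨T, R⟩ h
    simp only [mem_sigma, mem_powerset] at h ⊢
    exact ⟨union_subset h.1 (h.2.trans sdiff_subset), subset_union_left⟩
  · rintro ⟨V, T⟩ h
    simp only [mem_sigma, mem_powerset] at h ⊢
    exact ⟨h.2.trans h.1, sdiff_subset_sdiff h.1 subset_rfl⟩
  · rintro ⟨T, R⟩ h
    simp only [mem_sigma, mem_powerset] at h
    have : (T ∪ R) \ T = R := by
      ext x
      have := @h.2 x
      simp only [Finset.mem_sdiff, mem_union] at *
      tauto
    simp [this]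
  · rintro ⟨V, T⟩ h
    simp only [mem_sigma, mem_powerset] at h
    simp [union_sdiff_of_subset h.2]
  · rintro ⟨T, R⟩ h
    simp only [mem_sigma, mem_powerset] at h ⊢
    congr 1
    · ext x
      have := @h.2 x
      simp only [Finset.mem_sdiff, mem_union] at *
      tauto
    · ext x
      simp only [Finset.mem_sdiff, mem_union]
      tauto

lemma sum_powerset_sum_sdiff (S : Finset ι) (f : Finset ι → ι → A) :
    ∑ T ∈ S.powerset, ∑ a ∈ S \ T, f T a = ∑ a ∈ S, ∑ T ∈ (S.erase a).powerset, f T a := by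
  refine sum_comm' fun T a => ?_
  simp only [mem_powerset, Finset.mem_sdiff, subset_erase]
  tauto

lemma sum_sum_erase_comm (S : Finset ι) (f : ι → ι → A) :
    ∑ a ∈ S, ∑ d ∈ S.erase a, f a d = ∑ d ∈ S, ∑ a ∈ S.erase d, f a d :=
  sum_comm' (by intro x y; simp only [mem_erase]; tauto)

end PowersetSums

/-! ### Words with a fixed target -/

section Words

variable {ι A : Type*} [DecidableEq ι] [Ring A]

/-- The sum of the products `b (s 1) j * ⋯ * b (s m) j` over the sequences of `m` distinct elements
of `S`. -/
def wordSumAux (b : ι → ι → A) (j : ι) : ℕ → Finset ι → A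
  | 0, _ => 1
  | m + 1, S => ∑ a ∈ S, b a j * wordSumAux b j m (S.erase a)

/-- The sum of the products `b (s 1) j * ⋯ * b (s m) j` over the orderings `s` of `S`. -/
def wordSum (b : ι → ι → A) (j : ι) (S : Finset ι) : A := wordSumAux b j S.card S

variable {b : ι → ι → A}

lemma wordSum_empty (j : ι) : wordSum b j ∅ = 1 := rfl

lemma wordSum_of_nonempty (j : ι) {S : Finset ι} (hS : S.Nonempty) :
    wordSum b j S = ∑ a ∈ S, b a j * wordSum b j (S.erase a) := by
  obtain ⟨m, hm⟩ : ∃ m, S.card = m + 1 := ⟨S.card - 1, by have := hS.card_pos; omega⟩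
  rw [wordSum, hm, wordSumAux]
  refine sum_congr rfl fun a ha => ?_
  rw [wordSum, card_erase_of_mem ha, hm, Nat.add_sub_cancel]

lemma wordSum_eq (j : ι) (S : Finset ι) :
    wordSum b j S = (if S = ∅ then 1 else 0) + ∑ a ∈ S, b a j * wordSum b j (S.erase a) := by
  rcases S.eq_empty_or_nonempty with rfl | hS
  · simp [wordSum_empty]
  · rw [if_neg hS.ne_empty, zero_add, wordSum_of_nonempty j hS]

/-- Peeling off the last letter gives the same sum as peeling off the first: after peeling at both
ends, the two sums differ only in the order of summation over the end letters. -/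
lemma wordSum_eq_right (j : ι) (S : Finset ι) :
    wordSum b j S = (if S = ∅ then 1 else 0) + ∑ a ∈ S, wordSum b j (S.erase a) * b a j := by
  induction h : S.card using Nat.strong_induction_on generalizing S with
  | _ N ih =>
  subst h
  have e1 : wordSum b j S = (if S = ∅ then 1 else 0) +
      (∑ a ∈ S, (if S.erase a = ∅ then b a j else 0) +
        ∑ a ∈ S, ∑ d ∈ S.erase a, b a j * wordSum b j ((S.erase a).erase d) * b d j) := by
    rw [wordSum_eq, ← sum_add_distrib]
    congr 1
    refine sum_congr rfl fun a ha => ?_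
    rw [ih _ (card_erase_lt_of_mem ha) _ rfl, mul_add, mul_sum]
    simp only [mul_ite, mul_one, mul_zero, mul_assoc]
  have e2 : ∑ d ∈ S, wordSum b j (S.erase d) * b d j =
      ∑ a ∈ S, (if S.erase a = ∅ then b a j else 0) +
        ∑ d ∈ S, ∑ a ∈ S.erase d, b a j * wordSum b j ((S.erase a).erase d) * b d j := by
    rw [← sum_add_distrib]
    refine sum_congr rfl fun d _ => ?_
    rw [wordSum_eq, add_mul, sum_mul]
    simp only [ite_mul, one_mul, zero_mul, erase_right_comm (a := d)]
  rw [e1, e2, sum_sum_erase_comm]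

lemma commute_wordSum {j : ι} {S : Finset ι} {z : A} (h : ∀ a ∈ S, Commute z (b a j)) :
    Commute z (wordSum b j S) := by
  induction hN : S.card using Nat.strong_induction_on generalizing S with
  | _ N ih =>
  subst hN
  rw [wordSum_eq]
  refine Commute.add_right (by split_ifs <;> simp) (Commute.sum_right _ _ _ fun a ha => ?_)
  exact (h a ha).mul_right
    (ih _ (card_erase_lt_of_mem ha) (fun x hx => h x (mem_of_mem_erase hx)) rfl)

/-- The sums of products indexed by the maps from a subset of `S` to `J`, where the elements of
each fibre are multiplied in all possible orders. -/
def fibreSum (b : ι → ι → A) : List ι → Finset ι → A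
  | [], _ => 1
  | l :: J, S => ∑ T ∈ S.powerset, wordSum b l T * fibreSum b J (S \ T)

lemma commute_fibreSum {J : List ι} {S : Finset ι} {z : A}
    (h : ∀ l ∈ J, ∀ a ∈ S, Commute z (b a l)) : Commute z (fibreSum b J S) := by
  induction J generalizing S with
  | nil => exact Commute.one_right _
  | cons l J ih =>
    refine Commute.sum_right _ _ _ fun T hT => Commute.mul_right ?_ ?_
    · exact commute_wordSum fun a ha => h l (by simp) a (mem_powerset.1 hT ha)
    · exact ih fun m hm a ha => h m (by simp [hm]) a (Finset.mem_sdiff.1 ha).1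

end Words

/-! ### Consequences of the quadratic relations -/

section Quadratic

/-- The quadratic relations between elements `b i j`. -/
structure IsQuadratic {ι A : Type*} [Ring A] (b : ι → ι → A) : Prop where
  anti : ∀ i j, b i j = -b j i
  comm : ∀ i j k l, i ≠ j → k ≠ l → i ≠ k → i ≠ l → j ≠ k → j ≠ l → Commute (b i j) (b k l)
  three : ∀ i j k, i ≠ j → j ≠ k → k ≠ i → b i j * b j k + b j k * b k i + b k i * b i j = 0

lemma IsQuadratic.mul_eq {ι A : Type*} [Ring A] {b : ι → ι → A} (hb : IsQuadratic b)
    {a j l : ι} (haj : a ≠ j) (hjl : j ≠ l)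
    (hal : a ≠ l) : b a j * b j l = b j l * b a l + b a l * b a j := by
  have h := hb.three a j l haj hjl hal.symm
  rw [hb.anti l a, mul_neg, neg_mul] at h
  rw [← sub_eq_zero, ← h]
  abel

variable {ι A : Type*} [DecidableEq ι] [Ring A] {b : ι → ι → A}

/-- The three-term relation lets b x j pass b j l at the cost of words with target l alone, and b x
j commutes with every letter b d l for d different from x and j. Pushing b x j to the right through
the words on the right-hand side produces the left-hand side, by induction on S. -/
lemma wordSum_insert_aux (hb : IsQuadratic b) {j l : ι} (hjl : j ≠ l) (S : Finset ι)
    (hj : j ∉ S) (hl : l ∉ S) :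
    wordSum b l (insert j S) + wordSum b l S * ∑ a ∈ S, b a j =
      wordSum b l S * b j l + ∑ x ∈ S, b x j * wordSum b l (insert j (S.erase x)) := by
  have ins : ∀ S : Finset ι, j ∉ S → wordSum b l (insert j S) =
      b j l * wordSum b l S + ∑ x ∈ S, b x l * wordSum b l (insert j (S.erase x)) := by
    intro S hj
    rw [wordSum_of_nonempty _ (insert_nonempty j S), sum_insert hj, erase_insert hj]
    congr 1
    refine sum_congr rfl fun x hx => ?_
    rw [erase_insert_of_ne (ne_of_mem_of_not_mem hx hj).symm]
  induction hN : S.card using Nat.strong_induction_on generalizing S with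
  | _ N ih =>
  subst hN
  -- The inserted word starts either with b j l, where the three-term relation applies, or with some
  -- b d l, which commutes with b x j.
  have e1 : ∑ x ∈ S, b x j * wordSum b l (insert j (S.erase x)) =
      ∑ x ∈ S, (b j l * b x l * wordSum b l (S.erase x) +
        b x l * wordSum b l (S.erase x) * b x j) +
      ∑ d ∈ S, b d l * ∑ x ∈ S.erase d, b x j * wordSum b l (insert j ((S.erase d).erase x)) := by
    simp only [mul_sum]
    rw [sum_sum_erase_comm (f := fun d x =>
      b d l * (b x j * wordSum b l (insert j ((S.erase d).erase x)))), ← sum_add_distrib]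
    refine sum_congr rfl fun x hx => ?_
    have hxj := ne_of_mem_of_not_mem hx hj
    have hxl := ne_of_mem_of_not_mem hx hl
    rw [ins _ (fun h => hj (mem_of_mem_erase h)), mul_add, ← mul_assoc, hb.mul_eq hxj hjl hxl,
      add_mul, mul_sum, mul_assoc (b x l), (commute_wordSum (z := b x j) fun a ha => ?_).eq,
      ← mul_assoc (b x l)]
    · congr 1
      refine sum_congr rfl fun d hd => ?_
      rw [erase_right_comm, ← mul_assoc, ← mul_assoc,
        (hb.comm x j d l hxj (ne_of_mem_of_not_mem (mem_of_mem_erase hd) hl)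
          (ne_of_mem_erase hd).symm hxl
          (ne_of_mem_of_not_mem (mem_of_mem_erase hd) hj).symm hjl).eq]
    · exact hb.comm x j a l hxj (ne_of_mem_of_not_mem (mem_of_mem_erase ha) hl)
          (ne_of_mem_erase ha).symm hxl
          (ne_of_mem_of_not_mem (mem_of_mem_erase ha) hj).symm hjl
  have e2 : ∑ d ∈ S, b d l * ∑ x ∈ S.erase d, b x j * wordSum b l (insert j ((S.erase d).erase x)) =
      ∑ d ∈ S, (b d l * wordSum b l (insert j (S.erase d)) +
        b d l * wordSum b l (S.erase d) * ∑ a ∈ S.erase d, b a j -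
        b d l * wordSum b l (S.erase d) * b j l) := by
    refine sum_congr rfl fun d hd => ?_
    have := ih _ (card_erase_lt_of_mem hd) (S.erase d) (fun h => hj (mem_of_mem_erase h))
      (fun h => hl (mem_of_mem_erase h)) rfl
    rw [eq_sub_of_add_eq' this.symm]
    noncomm_ring
  have e3 : wordSum b l S * ∑ a ∈ S, b a j =
      ∑ d ∈ S, b d l * wordSum b l (S.erase d) * b d j +
      ∑ d ∈ S, b d l * wordSum b l (S.erase d) * ∑ a ∈ S.erase d, b a j := by
    rcases S.eq_empty_or_nonempty with rfl | hS
    · simp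
    rw [wordSum_of_nonempty _ hS, sum_mul, ← sum_add_distrib]
    refine sum_congr rfl fun d hd => ?_
    rw [← add_sum_erase _ _ hd, mul_add]
  have e4 := wordSum_eq (b := b) l S
  -- For nonempty S the four sums match by first-letter expansion; for empty S only the summand b j
  -- l remains on each side.
  have e5 : b j l * wordSum b l S + ∑ d ∈ S, b d l * wordSum b l (S.erase d) * b j l =
      ∑ x ∈ S, b j l * b x l * wordSum b l (S.erase x) + wordSum b l S * b j l := by
    rw [e4, mul_add, add_mul, mul_sum, sum_mul]
    simp only [mul_assoc, mul_ite, ite_mul, mul_one, one_mul, mul_zero, zero_mul]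
    abel
  rw [e1, e2, e3, ins S hj]
  simp only [sum_add_distrib, sum_sub_distrib]
  rw [← eq_sub_iff_add_eq] at e5
  rw [e5]
  abel

/-- The recursion for inserting an element into the set of letters. -/
lemma wordSum_insert (hb : IsQuadratic b) {j l : ι} (hjl : j ≠ l) {S : Finset ι}
    (hj : j ∉ S) (hl : l ∉ S) :
    wordSum b l (insert j S) = wordSum b l S * (b j l - ∑ a ∈ S, b a j) +
      ∑ x ∈ S, b x j * wordSum b l (insert j (S.erase x)) := by
  rw [mul_sub, sub_add_eq_add_sub, ← wordSum_insert_aux hb hjl S hj hl]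
  abel

/-- Iterating `wordSum_insert`: R collects the elements x whose factors b x j have been pulled out
to the left, and these form all words with target j on R. -/
lemma wordSum_insert_eq_sum (hb : IsQuadratic b) {j l : ι} (hjl : j ≠ l) {S : Finset ι}
    (hj : j ∉ S) (hl : l ∉ S) :
    wordSum b l (insert j S) = ∑ R ∈ S.powerset,
      wordSum b j R * wordSum b l (S \ R) * (b j l - ∑ a ∈ S \ R, b a j) := by
  induction hN : S.card using Nat.strong_induction_on generalizing S with
  | _ N ih =>
  subst hN
  rw [wordSum_insert hb hjl hj hl]
  have e : ∑ x ∈ S, b x j * wordSum b l (insert j (S.erase x)) =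
      ∑ x ∈ S, ∑ R ∈ (S.erase x).powerset, b x j * (wordSum b j R *
        wordSum b l (S.erase x \ R) * (b j l - ∑ a ∈ S.erase x \ R, b a j)) := by
    refine sum_congr rfl fun x hx => ?_
    rw [ih _ (card_erase_lt_of_mem hx) (fun h => hj (mem_of_mem_erase h))
      (fun h => hl (mem_of_mem_erase h)) rfl, mul_sum]
  rw [e, ← sum_powerset_sum_mem (f := fun x R T =>
    b x j * (wordSum b j R * wordSum b l T * (b j l - ∑ a ∈ T, b a j)))]
  have e' : wordSum b l S * (b j l - ∑ a ∈ S, b a j) = ∑ R ∈ S.powerset,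
      if R = ∅ then wordSum b l (S \ R) * (b j l - ∑ a ∈ S \ R, b a j) else 0 := by
    rw [sum_ite_eq' S.powerset ∅ fun R => wordSum b l (S \ R) * (b j l - ∑ a ∈ S \ R, b a j)]
    simp
  rw [e', ← sum_add_distrib]
  refine sum_congr rfl fun R _ => ?_
  nth_rewrite 3 [wordSum_eq]
  simp only [add_mul, sum_mul, ite_mul, one_mul, zero_mul, mul_assoc]

/-- The sum of the products `b (s 1) j * ⋯ * b (s m) j * b (s 1) j` over the orderings `s` of
`T`. -/
def cyclicSum (b : ι → ι → A) (j : ι) (T : Finset ι) : A :=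
  ∑ d ∈ T, b d j * wordSum b j (T.erase d) * b d j

/-- This recursion has the same shape as `sum_mul_wordSum_insert`, so that the two sides of
`cyclicSum_add` can be compared by induction. It comes from applying `wordSum_insert` between the
two copies of b d j and reordering with the three-term relation. -/
lemma cyclicSum_insert (hb : IsQuadratic b) {j z : ι} (hzj : z ≠ j) {S : Finset ι}
    (hz : z ∉ S) (hj : j ∉ S) (hS : S.Nonempty) :
    cyclicSum b j (insert z S) = ∑ x ∈ S, b x z * cyclicSum b j (insert z (S.erase x)) -
      cyclicSum b j S * ∑ x ∈ S, b x z := by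
  have ins : ∀ S : Finset ι, z ∉ S → cyclicSum b j (insert z S) =
      b z j * wordSum b j S * b z j +
        ∑ d ∈ S, b d j * wordSum b j (insert z (S.erase d)) * b d j := by
    intro S hz
    rw [cyclicSum, sum_insert hz, erase_insert hz]
    congr 1
    refine sum_congr rfl fun x hx => ?_
    rw [erase_insert_of_ne (ne_of_mem_of_not_mem hx hz).symm]
  -- The second term on the right, summed over d, is the first-letter expansion of b z j * `wordSum
  -- b j S` * b z j. It cancels the summand with repeated letter b z j; this is where S must be
  -- nonempty.
  have key : ∀ d ∈ S, b d j * wordSum b j (insert z (S.erase d)) * b d j =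
      b d z * (b z j * wordSum b j (S.erase d) * b z j) -
        b z j * (b d j * wordSum b j (S.erase d)) * b z j -
        b d j * wordSum b j (S.erase d) * b d j * ∑ x ∈ S, b x z +
        ∑ x ∈ S.erase d, b x z * (b d j * wordSum b j (insert z ((S.erase d).erase x)) * b d j) := by
    intro d hd
    have hdz := ne_of_mem_of_not_mem hd hz
    have hdj := ne_of_mem_of_not_mem hd hj
    have h1 : b z j * b d j = b d z * b z j - b d j * b d z := by
      rw [hb.mul_eq hdz hzj hdj]; abel
    have h2 : b d j * b d z = b d z * b z j - b z j * b d j := by rw [h1]; abel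
    have h3 : (∑ c ∈ S.erase d, b c z) * b d j = b d j * ∑ c ∈ S.erase d, b c z :=
      (Commute.sum_left _ _ _ fun c hc => hb.comm c z d j
        (ne_of_mem_of_not_mem (mem_of_mem_erase hc) hz) hdj (ne_of_mem_erase hc)
        (ne_of_mem_of_not_mem (mem_of_mem_erase hc) hj) hdz.symm hzj).eq
    have h4 : b d z * wordSum b j (S.erase d) = wordSum b j (S.erase d) * b d z :=
      (commute_wordSum fun c hc => hb.comm d z c j hdz
        (ne_of_mem_of_not_mem (mem_of_mem_erase hc) hj) (ne_of_mem_erase hc).symm hdj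
        (ne_of_mem_of_not_mem (mem_of_mem_erase hc) hz).symm hzj).eq
    have h5 : ∑ x ∈ S.erase d,
        b x z * (b d j * wordSum b j (insert z ((S.erase d).erase x)) * b d j) =
        b d j * (∑ x ∈ S.erase d, b x z * wordSum b j (insert z ((S.erase d).erase x))) *
          b d j := by
      rw [mul_sum, sum_mul]
      refine sum_congr rfl fun x hx => ?_
      have := (hb.comm x z d j (ne_of_mem_of_not_mem (mem_of_mem_erase hx) hz) hdj
        (ne_of_mem_erase hx) (ne_of_mem_of_not_mem (mem_of_mem_erase hx) hj) hdz.symm hzj).eq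
      simp only [← mul_assoc]
      rw [this]
    rw [wordSum_insert hb hzj (fun h => hz (mem_of_mem_erase h)) (fun h => hj (mem_of_mem_erase h)),
      h5, ← add_sum_erase _ _ hd]
    generalize wordSum b j (S.erase d) = w at *
    generalize (∑ c ∈ S.erase d, b c z) = s at *
    generalize (∑ x ∈ S.erase d, b x z * wordSum b j (insert z ((S.erase d).erase x))) = t at *
    have e1 : b d j * (w * (b z j - s) + t) * b d j =
        b d j * w * (b z j * b d j) - b d j * w * (s * b d j) + b d j * t * b d j := by
      noncomm_ring
    have e2 : b d z * (b z j * w * b z j) - b z j * (b d j * w) * b z j =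
        (b d z * b z j - b z j * b d j) * w * b z j := by noncomm_ring
    rw [e1, e2, ← h2, h1, h3, mul_assoc (b d j) (b d z), h4]
    noncomm_ring
  rw [ins S hz, sum_congr rfl key]
  have e : ∑ x ∈ S, b x z * cyclicSum b j (insert z (S.erase x)) =
      ∑ x ∈ S, b x z * (b z j * wordSum b j (S.erase x) * b z j) +
      ∑ d ∈ S, ∑ x ∈ S.erase d,
        b x z * (b d j * wordSum b j (insert z ((S.erase d).erase x)) * b d j) := by
    rw [sum_sum_erase_comm, ← sum_add_distrib]
    refine sum_congr rfl fun x hx => ?_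
    rw [ins _ (fun h => hz (mem_of_mem_erase h)), mul_add, mul_sum]
    simp only [erase_right_comm (a := x)]
  rw [e, wordSum_of_nonempty j hS, cyclicSum]
  simp only [sum_add_distrib, sum_sub_distrib, ← mul_sum, ← sum_mul]
  abel

end Quadratic

/-! ### Repeated letters and the deformed squares -/

section Square

/-- Elements `b i j` satisfying the quadratic relations, such that `b i j ^ 2` is the sum of `c i j`,
which commutes with all `b k l`, and of `-p i j`, which is permuted by commutation with `b k l`. -/
structure IsSquareDeformed {ι A : Type*} [DecidableEq ι] [Ring A] (b c p : ι → ι → A) : Prop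
    extends IsQuadratic b where
  sq : ∀ i j, i ≠ j → b i j * b i j = c i j - p i j
  comm_c : ∀ i j k l, Commute (c i j) (b k l)
  mul_p : ∀ i j k l, i ≠ j → b i j * p k l = p (Equiv.swap i j k) (Equiv.swap i j l) * b i j

variable {ι A : Type*} [DecidableEq ι] [Ring A] {b c p : ι → ι → A}

lemma IsSquareDeformed.mul_p_right (hb : IsSquareDeformed b c p) {i j k : ι} (hij : i ≠ j)
    (hki : k ≠ i) (hkj : k ≠ j) : b i j * p k j = p k i * b i j := by
  rw [hb.mul_p _ _ _ _ hij, Equiv.swap_apply_right, Equiv.swap_apply_of_ne_of_ne hki hkj]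

lemma IsSquareDeformed.mul_p_left (hb : IsSquareDeformed b c p) {i j k : ι} (hij : i ≠ j)
    (hki : k ≠ i) (hkj : k ≠ j) : b i j * p j k = p i k * b i j := by
  rw [hb.mul_p _ _ _ _ hij, Equiv.swap_apply_right, Equiv.swap_apply_of_ne_of_ne hki hkj]

lemma IsSquareDeformed.commute_p (hb : IsSquareDeformed b c p) {i j k l : ι} (hij : i ≠ j)
    (hki : k ≠ i) (hkj : k ≠ j) (hli : l ≠ i) (hlj : l ≠ j) : Commute (b i j) (p k l) := by
  rw [commute_iff_eq, hb.mul_p _ _ _ _ hij, Equiv.swap_apply_of_ne_of_ne hli hlj,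
    Equiv.swap_apply_of_ne_of_ne hki hkj]

/-- For a ∈ S, `wordSum_insert` is applied to words with target a. Its term b z a = -b a z supplies
the summand x = a missing from the sum over S \ {a}, so the factor on the right does not depend on
a. -/
lemma sum_mul_wordSum_insert (hb : IsSquareDeformed b c p) {j z : ι} {S : Finset ι}
    (hz : z ∉ S) (hS : S.Nonempty) :
    ∑ a ∈ insert z S, c a j * wordSum b a ((insert z S).erase a) =
      ∑ x ∈ S, b x z * ∑ a ∈ insert z (S.erase x),
        c a j * wordSum b a ((insert z (S.erase x)).erase a) -
      (∑ a ∈ S, c a j * wordSum b a (S.erase a)) * ∑ x ∈ S, b x z := by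
  have ins : ∀ S : Finset ι, z ∉ S →
      ∑ a ∈ insert z S, c a j * wordSum b a ((insert z S).erase a) =
      c z j * wordSum b z S + ∑ a ∈ S, c a j * wordSum b a (insert z (S.erase a)) := by
    intro S hz
    rw [sum_insert hz, erase_insert hz]
    congr 1
    refine sum_congr rfl fun x hx => ?_
    rw [erase_insert_of_ne (ne_of_mem_of_not_mem hx hz).symm]
  have e1 : ∑ a ∈ S, c a j * wordSum b a (insert z (S.erase a)) =
      ∑ a ∈ S, ∑ x ∈ S.erase a, b x z * (c a j * wordSum b a (insert z ((S.erase a).erase x))) -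
      ∑ a ∈ S, c a j * wordSum b a (S.erase a) * ∑ x ∈ S, b x z := by
    rw [← sum_sub_distrib]
    refine sum_congr rfl fun a ha => ?_
    have haz := ne_of_mem_of_not_mem ha hz
    have : ∑ x ∈ S.erase a, b x z * (c a j * wordSum b a (insert z ((S.erase a).erase x))) =
        c a j * ∑ x ∈ S.erase a, b x z * wordSum b a (insert z ((S.erase a).erase x)) := by
      rw [mul_sum]
      refine sum_congr rfl fun x _ => ?_
      rw [← mul_assoc, ← (hb.comm_c a j x z).eq, mul_assoc]
    rw [wordSum_insert hb.toIsQuadratic haz.symm (fun h => hz (mem_of_mem_erase h))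
      (notMem_erase a S), this, ← add_sum_erase S _ ha, hb.anti a z]
    noncomm_ring
  have e2 : ∑ x ∈ S, b x z * ∑ a ∈ insert z (S.erase x),
        c a j * wordSum b a ((insert z (S.erase x)).erase a) =
      c z j * wordSum b z S +
      ∑ a ∈ S, ∑ x ∈ S.erase a, b x z * (c a j * wordSum b a (insert z ((S.erase a).erase x))) := by
    rw [sum_sum_erase_comm, wordSum_of_nonempty _ hS, mul_sum, ← sum_add_distrib]
    refine sum_congr rfl fun x hx => ?_
    rw [ins _ (fun h => hz (mem_of_mem_erase h)), mul_add, mul_sum, ← mul_assoc, ← mul_assoc,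
      (hb.comm_c z j x z).eq]
    simp only [erase_right_comm (a := x)]
  rw [ins S hz, e1, e2, sum_mul]
  abel

/-- For a singleton this is the relation for b a j ^ 2. Larger sets follow because both sides obey
the same recursion; the p-correction, present only for singletons, affects only the step from one to
two elements, where it cancels by crossing. -/
lemma cyclicSum_add (hb : IsSquareDeformed b c p) {j : ι} {T : Finset ι} (hj : j ∉ T) :
    cyclicSum b j T + ∑ a ∈ T, (if T.erase a = ∅ then p a j else 0) =
      ∑ a ∈ T, c a j * wordSum b a (T.erase a) := by
  induction hN : T.card using Nat.strong_induction_on generalizing T with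
  | _ N ih =>
  subst hN
  rcases T.eq_empty_or_nonempty with rfl | ⟨z, hzT⟩
  · simp [cyclicSum]
  obtain ⟨S, hz, rfl⟩ : ∃ S, z ∉ S ∧ T = insert z S :=
    ⟨T.erase z, notMem_erase z T, (insert_erase hzT).symm⟩
  have hzj : z ≠ j := ne_of_mem_of_not_mem hzT hj
  have hjS : j ∉ S := fun h => hj (mem_insert_of_mem h)
  rcases S.eq_empty_or_nonempty with rfl | hS
  · simp [cyclicSum, wordSum_empty, hb.sq _ _ hzj]
  have h1 := ih _ (card_lt_card (ssubset_insert hz)) hjS rfl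
  have h2 : ∀ x ∈ S, cyclicSum b j (insert z (S.erase x)) =
      ∑ a ∈ insert z (S.erase x), c a j * wordSum b a ((insert z (S.erase x)).erase a) -
      if S.erase x = ∅ then p z j else 0 := by
    intro x hx
    have hzx : z ∉ S.erase x := fun h => hz (mem_of_mem_erase h)
    have := ih _ (by rw [card_insert_of_notMem hzx, card_insert_of_notMem hz]
                     exact Nat.add_lt_add_right (card_erase_lt_of_mem hx) 1)
      (T := insert z (S.erase x)) (fun h => hj (insert_subset_insert _ (erase_subset _ _) h)) rfl
    rw [← this, eq_sub_iff_add_eq]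
    congr 1
    -- Only a = z can contribute a correction: removing any other element leaves z in the set.
    rw [sum_insert hzx, erase_insert hzx, left_eq_add]
    refine sum_eq_zero fun a ha => if_neg ?_
    rw [erase_insert_of_ne (ne_of_mem_of_not_mem ha hzx).symm]
    exact (insert_nonempty _ _).ne_empty
  have h3 : ∑ a ∈ insert z S, (if (insert z S).erase a = ∅ then p a j else 0) = 0 := by
    refine sum_eq_zero fun a _ => if_neg fun h => ?_
    obtain ⟨x, hx⟩ := hS
    have h' : ∀ y ∈ insert z S, y = a := fun y hy => by
      by_contra hya
      exact notMem_empty y (h ▸ mem_erase.2 ⟨hya, hy⟩)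
    exact hz (h' z (mem_insert_self z S) ▸ h' x (mem_insert_of_mem hx) ▸ hx)
  -- Nonzero only for S = {x}, where it is the crossing rule b x z * p z j = p x j * b x z.
  have h4 : ∑ x ∈ S, b x z * (if S.erase x = ∅ then p z j else 0) =
      (∑ a ∈ S, if S.erase a = ∅ then p a j else 0) * ∑ x ∈ S, b x z := by
    rw [sum_mul]
    refine sum_congr rfl fun x hx => ?_
    split_ifs with h
    · rw [← add_sum_erase S (fun x => b x z) hx, h, sum_empty, add_zero,
        hb.mul_p_left (ne_of_mem_of_not_mem hx hz) (ne_of_mem_of_not_mem hx hjS).symm hzj.symm]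
    · simp
  rw [h3, add_zero, cyclicSum_insert hb.toIsQuadratic hzj hz hjS hS, sum_mul_wordSum_insert hb hz hS,
    ← h1, add_mul, ← h4]
  rw [sum_congr rfl fun x hx => by rw [h2 x hx]]
  simp only [mul_sub, sum_sub_distrib]
  abel

/-- The sum of the products `wordSum b a R * wordSum b j (S \ R)` over the subsets `R` of `S`. -/
def pairSum (b : ι → ι → A) (a j : ι) (S : Finset ι) : A :=
  ∑ R ∈ S.powerset, wordSum b a R * wordSum b j (S \ R)

lemma pairSum_comm (hb : IsQuadratic b) {a j : ι} (haj : a ≠ j) {S : Finset ι} (ha : a ∉ S)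
    (hj : j ∉ S) : pairSum b a j S = pairSum b j a S := by
  rw [pairSum, sum_powerset_compl (f := fun R T => wordSum b a R * wordSum b j T)]
  refine sum_congr rfl fun T hT => ?_
  refine (commute_wordSum fun y hy => (commute_wordSum fun x hx => ?_).symm).eq
  have hy' := mem_powerset.1 hT hy
  have hx' := (Finset.mem_sdiff.1 hx).1
  exact hb.comm y j x a (ne_of_mem_of_not_mem hy' hj) (ne_of_mem_of_not_mem hx' ha)
    (ne_of_mem_of_not_mem hy (Finset.mem_sdiff.1 hx).2) (ne_of_mem_of_not_mem hy' ha)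
    (ne_of_mem_of_not_mem hx' hj).symm haj.symm

/-- After the two commuting words are swapped, the word with target j is either empty or has a first
letter b d j. -/
lemma pairSum_eq (hb : IsQuadratic b) {a j : ι} (haj : a ≠ j) {S : Finset ι} (ha : a ∉ S)
    (hj : j ∉ S) : pairSum b a j S =
      wordSum b a S + ∑ d ∈ S, b d j * pairSum b a j (S.erase d) := by
  have e : ∑ d ∈ S, b d j * pairSum b a j (S.erase d) =
      ∑ d ∈ S, ∑ R ∈ (S.erase d).powerset,
        b d j * (wordSum b j R * wordSum b a (S.erase d \ R)) := by
    refine sum_congr rfl fun d _ => ?_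
    rw [pairSum_comm hb haj (fun h => ha (mem_of_mem_erase h)) (fun h => hj (mem_of_mem_erase h)),
      pairSum, mul_sum]
  have e' : wordSum b a S = ∑ R ∈ S.powerset, if R = ∅ then wordSum b a (S \ R) else 0 := by
    rw [sum_ite_eq' S.powerset ∅ fun R => wordSum b a (S \ R)]
    simp
  rw [e, ← sum_powerset_sum_mem (f := fun d R T => b d j * (wordSum b j R * wordSum b a T)), e',
    pairSum_comm hb haj ha hj, pairSum, ← sum_add_distrib]
  refine sum_congr rfl fun R _ => ?_
  nth_rewrite 1 [wordSum_eq]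
  simp only [add_mul, sum_mul, ite_mul, one_mul, zero_mul, mul_assoc]

/-- The first letter b e j is peeled off and moved to the left of p d a, with which it commutes. If
no letter is left to peel, p d a * b a j = b a j * p d j gives the singleton correction. -/
lemma sum_p_mul_wordSum (hb : IsSquareDeformed b c p) {j : ι} {T : Finset ι} (hj : j ∉ T) :
    ∑ a ∈ T, ∑ d ∈ T.erase a, p d a * wordSum b j ((T.erase a).erase d) * b a j =
      ∑ e ∈ T, b e j * (∑ a ∈ T.erase e, ∑ d ∈ (T.erase e).erase a,
        p d a * wordSum b j (((T.erase e).erase a).erase d) * b a j +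
        ∑ a ∈ T.erase e, if (T.erase e).erase a = ∅ then p a j else 0) := by
  have e1 : ∀ a ∈ T, ∑ d ∈ T.erase a, p d a * wordSum b j ((T.erase a).erase d) * b a j =
      ∑ d ∈ T.erase a, (if (T.erase a).erase d = ∅ then b a j * p d j else 0) +
      ∑ e ∈ T.erase a, ∑ d ∈ (T.erase a).erase e,
        b e j * (p d a * wordSum b j (((T.erase a).erase e).erase d) * b a j) := by
    intro a ha
    have haj := ne_of_mem_of_not_mem ha hj
    rw [sum_sum_erase_comm, ← sum_add_distrib]
    refine sum_congr rfl fun d hd => ?_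
    have hdj := ne_of_mem_of_not_mem (mem_of_mem_erase hd) hj
    have hda := ne_of_mem_erase hd
    rw [wordSum_eq, mul_add, add_mul, mul_sum, sum_mul]
    congr 1
    · split_ifs
      · rw [hb.mul_p_right haj hda hdj, mul_one]
      · simp
    · refine sum_congr rfl fun e he => ?_
      have hej := ne_of_mem_of_not_mem (mem_of_mem_erase (mem_of_mem_erase he)) hj
      have hea := ne_of_mem_erase (mem_of_mem_erase he)
      have hed := ne_of_mem_erase he
      rw [erase_right_comm (a := e)]
      simp only [← mul_assoc]
      rw [(hb.commute_p hej hed.symm hdj hea.symm haj).eq]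
  rw [sum_congr rfl e1, sum_add_distrib, sum_sum_erase_comm (f := fun a e =>
    ∑ d ∈ (T.erase a).erase e,
        b e j * (p d a * wordSum b j (((T.erase a).erase e).erase d) * b a j))]
  simp only [mul_add, mul_sum, sum_add_distrib, mul_ite, mul_zero]
  rw [add_comm]
  congr 1
  refine sum_congr rfl fun e _ => sum_congr rfl fun a _ => ?_
  rw [erase_right_comm]

/-- In a word followed by one of its own letters, first letters are peeled off until the repeated
one comes first; `cyclicSum_add` then applies to what remains. Its correction p d j, moved left
through the peeled letters, becomes p d a on crossing the last of them, b a j; hence the sum over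
ordered pairs. -/
lemma wordSum_mul_sum (hb : IsSquareDeformed b c p) {j : ι} {T : Finset ι} (hj : j ∉ T) :
    wordSum b j T * ∑ a ∈ T, b a j +
      (∑ a ∈ T, ∑ d ∈ T.erase a, p d a * wordSum b j ((T.erase a).erase d) * b a j +
      ∑ a ∈ T, if T.erase a = ∅ then p a j else 0) =
    ∑ a ∈ T, c a j * pairSum b a j (T.erase a) := by
  induction hN : T.card using Nat.strong_induction_on generalizing T with
  | _ N ih =>
  subst hN
  have e1 : wordSum b j T * ∑ a ∈ T, b a j =
      ∑ d ∈ T, b d j * (wordSum b j (T.erase d) * ∑ a ∈ T.erase d, b a j) + cyclicSum b j T := by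
    rw [cyclicSum, ← sum_add_distrib]
    rcases T.eq_empty_or_nonempty with rfl | hT
    · simp
    rw [wordSum_of_nonempty _ hT, sum_mul]
    refine sum_congr rfl fun d hd => ?_
    rw [← add_sum_erase _ _ hd]
    noncomm_ring
  have e2 : ∑ a ∈ T, c a j * pairSum b a j (T.erase a) =
      ∑ a ∈ T, c a j * wordSum b a (T.erase a) +
      ∑ d ∈ T, b d j * ∑ a ∈ T.erase d, c a j * pairSum b a j ((T.erase d).erase a) := by
    simp only [mul_sum]
    rw [← sum_sum_erase_comm (f := fun a d =>
      b d j * (c a j * pairSum b a j ((T.erase d).erase a))), ← sum_add_distrib]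
    refine sum_congr rfl fun a ha => ?_
    rw [pairSum_eq hb.toIsQuadratic (ne_of_mem_of_not_mem ha hj) (notMem_erase a T)
      (fun h => hj (mem_of_mem_erase h)), mul_add, mul_sum]
    congr 1
    refine sum_congr rfl fun d _ => ?_
    rw [erase_right_comm, ← mul_assoc, ← mul_assoc, (hb.comm_c a j d j).eq]
  have e3 : ∀ d ∈ T, b d j * ∑ a ∈ T.erase d, c a j * pairSum b a j ((T.erase d).erase a) =
      b d j * (wordSum b j (T.erase d) * ∑ a ∈ T.erase d, b a j) +
      b d j * (∑ a ∈ T.erase d, ∑ x ∈ (T.erase d).erase a,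
        p x a * wordSum b j (((T.erase d).erase a).erase x) * b a j +
        ∑ a ∈ T.erase d, if (T.erase d).erase a = ∅ then p a j else 0) := by
    intro d hd
    rw [← mul_add, ← ih _ (card_erase_lt_of_mem hd) (fun h => hj (mem_of_mem_erase h)) rfl]
  rw [e2, sum_congr rfl e3, sum_add_distrib, ← sum_p_mul_wordSum hb hj, ← cyclicSum_add hb hj, e1]
  abel

end Square

/-! ### The Pieri-type formula for partial sets of variables -/

section Pieri

variable {ι A : Type*} [DecidableEq ι] [Ring A] {b : ι → ι → A}

lemma fibreSum_cons_cons (j l : ι) (J : List ι) (S : Finset ι) : fibreSum b (j :: l :: J) S =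
    ∑ V ∈ S.powerset, pairSum b j l V * fibreSum b J (S \ V) := by
  simp only [fibreSum, mul_sum, pairSum, sum_mul]
  rw [sum_powerset_assoc S (fun T R U => wordSum b j T * (wordSum b l R * fibreSum b J U))]
  simp only [mul_assoc]

lemma fibreSum_swap (hb : IsQuadratic b) {j l : ι} (hjl : j ≠ l) (J : List ι) {S : Finset ι}
    (hj : j ∉ S) (hl : l ∉ S) : fibreSum b (j :: l :: J) S = fibreSum b (l :: j :: J) S := by
  rw [fibreSum_cons_cons, fibreSum_cons_cons]
  refine sum_congr rfl fun V hV => ?_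
  rw [pairSum_comm hb hjl (fun h => hj (mem_powerset.1 hV h)) (fun h => hl (mem_powerset.1 hV h))]

lemma sum_wordSum (j : ι) (S : Finset ι) : ∑ T ∈ S.powerset, wordSum b j T =
    1 + ∑ T ∈ S.powerset, wordSum b j T * ∑ a ∈ S \ T, b a j := by
  have e1 : ∑ T ∈ S.powerset, wordSum b j T * ∑ a ∈ S \ T, b a j =
      ∑ T ∈ S.powerset, ∑ a ∈ T, wordSum b j (T.erase a) * b a j := by
    simp only [mul_sum]
    rw [sum_powerset_sum_sdiff, sum_powerset_sum_mem (f := fun a T _ => wordSum b j T * b a j)]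
  have e2 : (1 : A) = ∑ T ∈ S.powerset, if T = ∅ then 1 else 0 := by
    rw [sum_ite_eq' S.powerset ∅ fun _ => (1 : A)]
    simp
  rw [e1, e2, ← sum_add_distrib]
  exact sum_congr rfl fun T _ => wordSum_eq_right j T

/-- Multiplication by 1 + θ_j, restricted to S and J, turns j from a target into a source. The
subtracted sum consists of words with target j followed by one of their own letters. For empty J
this follows from peeling off last letters; each further target is added by induction. -/
lemma fibreSum_mul (hb : IsQuadratic b) {j : ι} {J : List ι} {S : Finset ι} (hj : j ∉ S)
    (hJ : ∀ l ∈ J, l ∉ S) (hn : (j :: J).Nodup) :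
    fibreSum b (j :: J) S * (1 + ∑ a ∈ S, b j a + (J.map (b j)).sum) =
      fibreSum b J (insert j S) -
        ∑ T ∈ S.powerset, wordSum b j T * (∑ a ∈ T, b a j) * fibreSum b J (S \ T) := by
  have anti : ∀ S : Finset ι, ∑ a ∈ S, b j a = -∑ a ∈ S, b a j := fun S => by
    rw [← sum_neg_distrib]
    exact sum_congr rfl fun a _ => hb.anti j a
  induction J generalizing S with
  | nil =>
    simp only [fibreSum, mul_one, List.map_nil, List.sum_nil, add_zero, anti]
    have e : (∑ T ∈ S.powerset, wordSum b j T) * ∑ a ∈ S, b a j =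
        ∑ T ∈ S.powerset, wordSum b j T * ∑ a ∈ S \ T, b a j +
        ∑ T ∈ S.powerset, wordSum b j T * ∑ a ∈ T, b a j := by
      rw [sum_mul, ← sum_add_distrib]
      refine sum_congr rfl fun T hT => ?_
      rw [← mul_add, sum_sdiff (mem_powerset.1 hT)]
    rw [mul_add, mul_neg, e, mul_one, sum_wordSum]
    abel
  | cons l J ih =>
    have hjl : j ≠ l := fun h => (List.nodup_cons.1 hn).1 (h ▸ List.mem_cons_self)
    have hjJ : j ∉ J := fun h => (List.nodup_cons.1 hn).1 (List.mem_cons_of_mem _ h)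
    have hlJ : l ∉ J := (List.nodup_cons.1 (List.nodup_cons.1 hn).2).1
    have hl : l ∉ S := hJ l (by simp)
    have hJS : ∀ m ∈ J, m ∉ S := fun m hm => hJ m (by simp [hm])
    have hn' : (j :: J).Nodup := List.nodup_cons.2
      ⟨hjJ, (List.nodup_cons.1 (List.nodup_cons.1 hn).2).2⟩
    have e1 : fibreSum b (j :: l :: J) S *
          (1 + ∑ a ∈ S, b j a + ((l :: J).map (b j)).sum) =
        ∑ R ∈ S.powerset, wordSum b l R * fibreSum b J (insert j (S \ R)) -
        ∑ R ∈ S.powerset, ∑ T ∈ (S \ R).powerset, wordSum b l R *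
          (wordSum b j T * (∑ a ∈ T, b a j) * fibreSum b J ((S \ R) \ T)) +
        ∑ R ∈ S.powerset, ∑ T ∈ (S \ R).powerset, wordSum b l R *
          (wordSum b j T * fibreSum b J ((S \ R) \ T)) * (b j l - ∑ a ∈ R, b a j) := by
      -- With l outermost, the inner sum has targets j and J and sources S \ R. The induction
      -- hypothesis absorbs all of the factor except b j l and the terms with a ∈ R.
      rw [fibreSum_swap hb hjl J hj hl, fibreSum, sum_mul, ← sum_sub_distrib, ← sum_add_distrib]
      refine sum_congr rfl fun R hR => ?_
      rw [← mul_sum, ← mul_sub, ← ih (fun h => hj (Finset.mem_sdiff.1 h).1)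
        (fun m hm h => hJS m hm (Finset.mem_sdiff.1 h).1) hn', ← sum_mul, ← mul_sum, ← fibreSum,
        ← sum_sdiff (mem_powerset.1 hR), List.map_cons, List.sum_cons, anti R]
      noncomm_ring
    have e2 : ∑ R ∈ S.powerset, ∑ T ∈ (S \ R).powerset, wordSum b l R *
          (wordSum b j T * (∑ a ∈ T, b a j) * fibreSum b J ((S \ R) \ T)) =
        ∑ T ∈ S.powerset, wordSum b j T * (∑ a ∈ T, b a j) * fibreSum b (l :: J) (S \ T) := by
      have h : ∀ T, wordSum b j T * (∑ a ∈ T, b a j) * fibreSum b (l :: J) (S \ T) =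
          ∑ R ∈ (S \ T).powerset, wordSum b j T * (∑ a ∈ T, b a j) *
            (wordSum b l R * fibreSum b J ((S \ T) \ R)) := fun T => by rw [fibreSum, mul_sum]
      simp only [h]
      rw [sum_powerset_assoc S (fun R T U => wordSum b l R *
          (wordSum b j T * (∑ a ∈ T, b a j) * fibreSum b J U)),
        sum_powerset_assoc S (fun T R U => wordSum b j T * (∑ a ∈ T, b a j) *
          (wordSum b l R * fibreSum b J U))]
      refine sum_congr rfl fun V hV => ?_
      rw [sum_powerset_compl V (fun R T => wordSum b l R *
          (wordSum b j T * (∑ a ∈ T, b a j) * fibreSum b J (S \ V)))]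
      refine sum_congr rfl fun T hT => ?_
      have hVS := mem_powerset.1 hV
      have hTV := mem_powerset.1 hT
      have hcomm : ∀ y ∈ T, Commute (b y j) (wordSum b l (V \ T)) := fun y hy =>
        commute_wordSum fun x hx => hb.comm y j x l (ne_of_mem_of_not_mem (hVS (hTV hy)) hj)
          (ne_of_mem_of_not_mem (hVS (Finset.mem_sdiff.1 hx).1) hl)
          (ne_of_mem_of_not_mem hy (Finset.mem_sdiff.1 hx).2)
          (ne_of_mem_of_not_mem (hVS (hTV hy)) hl)
          (ne_of_mem_of_not_mem (hVS (Finset.mem_sdiff.1 hx).1) hj).symm hjl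
      have h : Commute (wordSum b l (V \ T)) (wordSum b j T * ∑ a ∈ T, b a j) :=
        (commute_wordSum fun y hy => (hcomm y hy).symm).mul_right
          (Commute.sum_right _ _ _ fun y hy => (hcomm y hy).symm)
      rw [← mul_assoc, h.eq, mul_assoc]
    -- The leftover factor commutes with the words having targets in J, and `wordSum_insert_eq_sum`
    -- recombines it into the words with target l that contain j as a source.
    have e3 : ∑ R ∈ S.powerset, ∑ T ∈ (S \ R).powerset, wordSum b l R *
          (wordSum b j T * fibreSum b J ((S \ R) \ T)) * (b j l - ∑ a ∈ R, b a j) =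
        ∑ V ∈ S.powerset, wordSum b l (insert j V) * fibreSum b J (S \ V) := by
      rw [sum_powerset_assoc S (fun R T U => wordSum b l R *
          (wordSum b j T * fibreSum b J U) * (b j l - ∑ a ∈ R, b a j))]
      refine sum_congr rfl fun V hV => ?_
      have hVS := mem_powerset.1 hV
      rw [wordSum_insert_eq_sum hb hjl (fun h => hj (hVS h)) (fun h => hl (hVS h)), sum_mul,
        ← sum_powerset_compl V (fun R T => wordSum b j T * wordSum b l R *
          (b j l - ∑ a ∈ R, b a j) * fibreSum b J (S \ V))]
      refine sum_congr rfl fun R hR => ?_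
      have hRV := mem_powerset.1 hR
      have h1 : Commute (b j l - ∑ a ∈ R, b a j) (fibreSum b J (S \ V)) := by
        refine Commute.sub_left ?_ (Commute.sum_left _ _ _ fun y hy => ?_) <;>
          refine commute_fibreSum fun m hm x hx => ?_
        · exact hb.comm j l x m hjl (ne_of_mem_of_not_mem (Finset.mem_sdiff.1 hx).1 (hJS m hm))
            (ne_of_mem_of_not_mem (Finset.mem_sdiff.1 hx).1 hj).symm (ne_of_mem_of_not_mem hm hjJ).symm
            (ne_of_mem_of_not_mem (Finset.mem_sdiff.1 hx).1 hl).symm (ne_of_mem_of_not_mem hm hlJ).symm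
        · exact hb.comm y j x m (ne_of_mem_of_not_mem (hVS (hRV hy)) hj)
            (ne_of_mem_of_not_mem (Finset.mem_sdiff.1 hx).1 (hJS m hm))
            (ne_of_mem_of_not_mem (hRV hy) (Finset.mem_sdiff.1 hx).2)
            (ne_of_mem_of_not_mem (hVS (hRV hy)) (hJS m hm))
            (ne_of_mem_of_not_mem (Finset.mem_sdiff.1 hx).1 hj).symm (ne_of_mem_of_not_mem hm hjJ).symm
      have h2 : Commute (wordSum b l R) (wordSum b j (V \ R)) := by
        refine commute_wordSum fun x hx => (commute_wordSum fun y hy => ?_).symm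
        exact hb.comm x j y l (ne_of_mem_of_not_mem (hVS (Finset.mem_sdiff.1 hx).1) hj)
          (ne_of_mem_of_not_mem (hVS (hRV hy)) hl)
          (ne_of_mem_of_not_mem hy (Finset.mem_sdiff.1 hx).2).symm
          (ne_of_mem_of_not_mem (hVS (Finset.mem_sdiff.1 hx).1) hl)
          (ne_of_mem_of_not_mem (hVS (hRV hy)) hj).symm hjl
      rw [← mul_assoc, h2.eq, mul_assoc, ← h1.eq, ← mul_assoc]
    have e4 : fibreSum b (l :: J) (insert j S) =
        ∑ R ∈ S.powerset, wordSum b l R * fibreSum b J (insert j (S \ R)) +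
        ∑ V ∈ S.powerset, wordSum b l (insert j V) * fibreSum b J (S \ V) := by
      rw [fibreSum, sum_powerset_insert hj]
      congr 1 <;> refine sum_congr rfl fun R hR => ?_
      · rw [insert_sdiff_of_notMem _ fun h => hj (mem_powerset.1 hR h)]
      · rw [insert_sdiff_insert, sdiff_insert_of_notMem hj]
    rw [e1, e2, e3, e4]
    abel

/-- The sum of the products of `f U` and `fibreSum b J (I \ U)` over the subsets `U` of `I`. -/
def pieriSum (b : ι → ι → A) (f : Finset ι → A) (J : List ι) (I : Finset ι) : A :=
  ∑ U ∈ I.powerset, f U * fibreSum b J (I \ U)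

variable {c p : ι → ι → A}

/-- This is `wordSum_mul_sum` on each U \ V, weighted by f V. The p-terms it produces are what the
matching recursion consumes: the singleton corrections build f (U ∪ {j}), and the others build the
products with a ∈ V. -/
lemma matching_identity (hb : IsSquareDeformed b c p) {f : Finset ι → A}
    (hf : ∀ U, ∀ j ∉ U, f (insert j U) = ∑ a ∈ U, f (U.erase a) * p a j)
    {j : ι} {U : Finset ι} (hj : j ∉ U) :
    f (insert j U) + ∑ V ∈ U.powerset, f V * wordSum b j (U \ V) * ∑ a ∈ U, b a j =
      ∑ V ∈ U.powerset, f V * ∑ a ∈ U \ V, c a j * pairSum b a j ((U \ V).erase a) := by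
  have e1 : ∑ V ∈ U.powerset, f V * ∑ a ∈ U \ V, c a j * pairSum b a j ((U \ V).erase a) =
      ∑ V ∈ U.powerset, f V * wordSum b j (U \ V) * ∑ a ∈ U \ V, b a j +
      (∑ V ∈ U.powerset, ∑ a ∈ U \ V, ∑ d ∈ (U.erase a) \ V,
        f V * (p d a * wordSum b j (((U.erase a) \ V).erase d) * b a j) +
      ∑ V ∈ U.powerset, ∑ a ∈ U \ V, if (U.erase a) \ V = ∅ then f V * p a j else 0) := by
    rw [← sum_add_distrib, ← sum_add_distrib]
    refine sum_congr rfl fun V _ => ?_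
    rw [← wordSum_mul_sum hb fun h => hj (Finset.mem_sdiff.1 h).1, mul_add, mul_add, mul_assoc]
    simp only [mul_sum (a := f V), erase_sdiff_comm, mul_ite, mul_zero]
  -- The condition forces V = U \ {a}, which leaves the expansion of f by the partner a of j.
  have e2 : ∑ V ∈ U.powerset, ∑ a ∈ U \ V, (if (U.erase a) \ V = ∅ then f V * p a j else 0) =
      f (insert j U) := by
    rw [sum_powerset_sum_sdiff, hf U j hj]
    refine sum_congr rfl fun a _ => ?_
    rw [sum_eq_single (U.erase a)]
    · simp
    · intro V hV hVa
      exact if_neg fun h => hVa ((mem_powerset.1 hV).antisymm (sdiff_eq_empty_iff_subset.1 h))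
    · simp
  -- Here d is the partner of a in the matching, so f V * p d a sums to f on the set enlarged by a
  -- and d.
  have e3 : ∑ V ∈ U.powerset, ∑ a ∈ U \ V, ∑ d ∈ (U.erase a) \ V,
        f V * (p d a * wordSum b j (((U.erase a) \ V).erase d) * b a j) =
      ∑ V ∈ U.powerset, f V * wordSum b j (U \ V) * ∑ a ∈ V, b a j := by
    rw [sum_powerset_sum_sdiff]
    have h1 : ∑ V ∈ U.powerset, f V * wordSum b j (U \ V) * ∑ a ∈ V, b a j =
        ∑ V ∈ U.powerset, ∑ a ∈ V, (∑ d ∈ V.erase a, f ((V.erase a).erase d) * p d a) *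
          wordSum b j (U \ V) * b a j := by
      refine sum_congr rfl fun V _ => ?_
      rw [mul_sum]
      refine sum_congr rfl fun a ha => ?_
      rw [← hf _ _ (notMem_erase a V), insert_erase ha]
    rw [h1, sum_powerset_sum_mem (f := fun a V W => (∑ d ∈ V, f (V.erase d) * p d a) *
          wordSum b j W * b a j)]
    refine sum_congr rfl fun a _ => ?_
    simp only [sum_mul]
    rw [sum_powerset_sum_mem (f := fun d V W => f V * p d a * wordSum b j W * b a j),
      sum_powerset_sum_sdiff]
    refine sum_congr rfl fun d _ => sum_congr rfl fun V _ => ?_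
    simp only [erase_sdiff_comm, mul_assoc]
  have e4 : ∑ V ∈ U.powerset, f V * wordSum b j (U \ V) * ∑ a ∈ U, b a j =
      ∑ V ∈ U.powerset, f V * wordSum b j (U \ V) * ∑ a ∈ U \ V, b a j +
      ∑ V ∈ U.powerset, f V * wordSum b j (U \ V) * ∑ a ∈ V, b a j := by
    rw [← sum_add_distrib]
    refine sum_congr rfl fun V hV => ?_
    rw [← mul_add, sum_sdiff (mem_powerset.1 hV)]
  rw [e1, e2, e3, e4]
  abel

/-- A subset of I ∪ {j} either omits j, giving the main term of `fibreSum_mul`, or contains it,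
giving f (U ∪ {j}). The latter together with the error terms equals the c-terms by
`matching_identity`, since the two new targets i and j contribute a `pairSum`. -/
lemma pieriSum_insert (hb : IsSquareDeformed b c p) {f : Finset ι → A}
    (hf : ∀ U, ∀ j ∉ U, f (insert j U) = ∑ a ∈ U, f (U.erase a) * p a j)
    (hc : ∀ i j U, Commute (c i j) (f U))
    {j : ι} {J : List ι} {I : Finset ι} (hj : j ∉ I)
    (hJ : ∀ l ∈ J, l ∉ I) (hn : (j :: J).Nodup) :
    pieriSum b f J (insert j I) =
      pieriSum b f (j :: J) I * (1 + ∑ a ∈ I, b j a + (J.map (b j)).sum) +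
      ∑ i ∈ I, c i j * pieriSum b f (i :: j :: J) (I.erase i) := by
  have hq := hb.toIsQuadratic
  have hjJ : j ∉ J := (List.nodup_cons.1 hn).1
  have e1 : pieriSum b f J (insert j I) =
      ∑ U ∈ I.powerset, f U * fibreSum b J (insert j (I \ U)) +
      ∑ U ∈ I.powerset, f (insert j U) * fibreSum b J (I \ U) := by
    rw [pieriSum, sum_powerset_insert hj]
    congr 1 <;> refine sum_congr rfl fun R hR => ?_
    · rw [insert_sdiff_of_notMem _ fun h => hj (mem_powerset.1 hR h)]
    · rw [insert_sdiff_insert, sdiff_insert_of_notMem hj]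
  have e2 : pieriSum b f (j :: J) I * (1 + ∑ a ∈ I, b j a + (J.map (b j)).sum) =
      ∑ U ∈ I.powerset, f U * fibreSum b J (insert j (I \ U)) -
      ∑ V ∈ I.powerset, (∑ U ∈ V.powerset, f U * wordSum b j (V \ U) * ∑ a ∈ V, b a j) *
        fibreSum b J (I \ V) := by
    -- The errors have two sources: a in the word's own set T, from `fibreSum_mul`, and a in the
    -- matched set U, from the part of θ_j that it does not use.
    have h1 : ∑ V ∈ I.powerset, (∑ U ∈ V.powerset, f U * wordSum b j (V \ U) * ∑ a ∈ V, b a j) *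
        fibreSum b J (I \ V) = ∑ U ∈ I.powerset, ∑ T ∈ (I \ U).powerset,
          f U * wordSum b j T * (∑ a ∈ U, b a j + ∑ a ∈ T, b a j) *
            fibreSum b J ((I \ U) \ T) := by
      rw [sum_powerset_assoc I (fun U T W =>
        f U * wordSum b j T * (∑ a ∈ U, b a j + ∑ a ∈ T, b a j) * fibreSum b J W)]
      refine sum_congr rfl fun V _ => ?_
      rw [sum_mul]
      refine sum_congr rfl fun U hU => ?_
      rw [add_comm (∑ a ∈ U, b a j), sum_sdiff (mem_powerset.1 hU)]
    rw [h1, pieriSum, sum_mul, ← sum_sub_distrib]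
    refine sum_congr rfl fun U hU => ?_
    have hUI := mem_powerset.1 hU
    have h2 : fibreSum b (j :: J) (I \ U) * ∑ a ∈ U, b j a =
        -∑ T ∈ (I \ U).powerset, wordSum b j T * (∑ a ∈ U, b a j) *
          fibreSum b J ((I \ U) \ T) := by
      rw [fibreSum, sum_mul, ← sum_neg_distrib]
      refine sum_congr rfl fun T _ => ?_
      have h3 : Commute (∑ a ∈ U, b a j) (fibreSum b J ((I \ U) \ T)) := by
        refine Commute.sum_left _ _ _ fun y hy => commute_fibreSum fun m hm x hx => ?_
        have hx' := Finset.mem_sdiff.1 (Finset.mem_sdiff.1 hx).1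
        exact hb.comm y j x m (ne_of_mem_of_not_mem (hUI hy) hj)
          (ne_of_mem_of_not_mem hx'.1 (hJ m hm)) (ne_of_mem_of_not_mem hy hx'.2)
          (ne_of_mem_of_not_mem (hUI hy) (hJ m hm)) (ne_of_mem_of_not_mem hx'.1 hj).symm
          (ne_of_mem_of_not_mem hm hjJ).symm
      rw [sum_congr rfl fun a _ => hb.anti j a, sum_neg_distrib, mul_neg, mul_assoc, ← h3.eq,
        ← mul_assoc]
    have h4 := fibreSum_mul hq (S := I \ U) (fun h => hj (Finset.mem_sdiff.1 h).1)
      (fun m hm h => hJ m hm (Finset.mem_sdiff.1 h).1) hn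
    have h5 : fibreSum b (j :: J) (I \ U) * (1 + ∑ a ∈ I, b j a + (J.map (b j)).sum) =
        fibreSum b (j :: J) (I \ U) * (1 + ∑ a ∈ I \ U, b j a + (J.map (b j)).sum) +
        fibreSum b (j :: J) (I \ U) * ∑ a ∈ U, b j a := by
      rw [← sum_sdiff hUI]
      noncomm_ring
    rw [mul_assoc, h5, h4, h2]
    simp only [mul_add, add_mul, sum_add_distrib, mul_sub, mul_neg]
    simp only [mul_sum (a := f U), mul_assoc]
    abel
  have e3 : ∑ i ∈ I, c i j * pieriSum b f (i :: j :: J) (I.erase i) =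
      ∑ V ∈ I.powerset, (∑ U ∈ V.powerset,
        f U * ∑ a ∈ V \ U, c a j * pairSum b a j ((V \ U).erase a)) * fibreSum b J (I \ V) := by
    let g : ι → Finset ι → Finset ι → Finset ι → A := fun i U T W =>
      f U * (c i j * pairSum b i j T * fibreSum b J W)
    have h1 : ∑ i ∈ I, c i j * pieriSum b f (i :: j :: J) (I.erase i) =
        ∑ i ∈ I, ∑ U ∈ (I.erase i).powerset, ∑ T ∈ ((I \ U).erase i).powerset,
          g i U T (((I \ U).erase i) \ T) := by
      refine sum_congr rfl fun i _ => ?_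
      rw [pieriSum, mul_sum]
      refine sum_congr rfl fun U _ => ?_
      rw [fibreSum_cons_cons, ← mul_assoc, (hc i j U).eq, mul_assoc, mul_sum, mul_sum,
        erase_sdiff_comm]
      simp only [g, mul_assoc]
    rw [h1, ← sum_powerset_sum_sdiff I fun U i => ∑ T ∈ ((I \ U).erase i).powerset,
          g i U T (((I \ U).erase i) \ T)]
    have h2 : ∀ U, ∑ i ∈ I \ U, ∑ T ∈ ((I \ U).erase i).powerset,
          g i U T (((I \ U).erase i) \ T) =
        ∑ T ∈ (I \ U).powerset, ∑ i ∈ T, g i U (T.erase i) ((I \ U) \ T) := fun U => by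
      rw [sum_powerset_sum_mem (f := fun i T W => g i U T W)]
    simp only [h2]
    rw [sum_powerset_assoc I fun U T W => ∑ i ∈ T, g i U (T.erase i) W]
    refine sum_congr rfl fun V _ => ?_
    rw [sum_mul]
    refine sum_congr rfl fun U _ => ?_
    rw [mul_assoc, sum_mul, mul_sum]
  rw [e1, e2, e3, ← sum_congr rfl fun V hV => congrArg (· * fibreSum b J (I \ V))
    (matching_identity hb hf fun h => hj (mem_powerset.1 hV h))]
  simp only [add_mul, sum_add_distrib]
  abel

/-- By induction on I, the function e agrees with `pieriSum` for every enumeration J of the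
complement of I. Allowing arbitrary enumerations lets j and then i be put at the head of J. For I
full the list is empty. -/
theorem sum_matchings_of_recursion [Fintype ι] (hb : IsSquareDeformed b c p) {f : Finset ι → A}
    (hf0 : f ∅ = 1) (hf : ∀ U, ∀ j ∉ U, f (insert j U) = ∑ a ∈ U, f (U.erase a) * p a j)
    (hc : ∀ i j U, Commute (c i j) (f U)) {e : Finset ι → A} (he0 : e ∅ = 1)
    (he : ∀ I, ∀ j ∉ I, e (insert j I) =
      e I * (1 + ∑ i ∈ univ.erase j, b j i) + ∑ i ∈ I, c i j * e (I.erase i)) :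
    e univ = ∑ U, f U := by
  have key : ∀ (I : Finset ι) (J : List ι), J.Nodup → (∀ l, l ∈ J ↔ l ∉ I) →
      e I = pieriSum b f J I := by
    intro I
    induction hN : I.card using Nat.strong_induction_on generalizing I with
    | _ N ih =>
    subst hN
    intro J hn hJ
    rcases I.eq_empty_or_nonempty with rfl | ⟨j, hjI⟩
    · have : fibreSum b J ∅ = 1 := by
        clear hn hJ ih
        induction J with
        | nil => rfl
        | cons l J ih => simp [fibreSum, wordSum_empty, ih]
      simp [pieriSum, he0, hf0, this]
    obtain ⟨I, hj, rfl⟩ : ∃ S, j ∉ S ∧ I = insert j S :=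
      ⟨I.erase j, notMem_erase j I, (insert_erase hjI).symm⟩
    have hn' : (j :: J).Nodup := List.nodup_cons.2 ⟨fun h => (hJ j).1 h hjI, hn⟩
    rw [he I j hj, pieriSum_insert hb hf hc hj
        (fun l hl h => (hJ l).1 hl (mem_insert_of_mem h)) hn',
      ih _ (card_lt_card (ssubset_insert hj)) I rfl (j :: J) hn' ?_]
    · congr 1
      · congr 1
        rw [add_assoc, ← List.sum_toFinset _ hn, ← sum_union]
        · congr 2
          ext x
          simp only [mem_erase, mem_univ, and_true, mem_union, List.mem_toFinset, hJ, mem_insert]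
          have : x ∈ I → x ≠ j := fun h => ne_of_mem_of_not_mem h hj
          tauto
        · rw [disjoint_left]
          intro x hx hx'
          exact (hJ x).1 (List.mem_toFinset.1 hx') (mem_insert_of_mem hx)
      · refine sum_congr rfl fun i hi => ?_
        rw [ih _ ((card_erase_lt_of_mem hi).trans (card_lt_card (ssubset_insert hj))) _ rfl
          (i :: j :: J)]
        · refine List.nodup_cons.2 ⟨fun h => ?_, hn'⟩
          rcases List.mem_cons.1 h with rfl | h
          · exact hj hi
          · exact (hJ i).1 h (mem_insert_of_mem hi)
        · intro l
          simp only [List.mem_cons, hJ, mem_insert, mem_erase]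
          have : l = i → l ∈ I := fun h => h ▸ hi
          have : l = j → l ∉ I := fun h => h ▸ hj
          tauto
    · intro l
      simp only [List.mem_cons, hJ, mem_insert]
      have : l = j → l ∉ I := fun h => h ▸ hj
      tauto
  rw [key univ [] List.nodup_nil (by simp), pieriSum]
  simp [fibreSum]

end Pieri

/-! ### Recovering the degree with power series -/

section Graded

open PowerSeries

/-- All relations are homogeneous when b has degree 1 and c and p have degree 2. -/
lemma isSquareDeformed_monomial {ι A : Type*} [DecidableEq ι] [Ring A] {b c p : ι → ι → A}
    (hb : IsSquareDeformed b c p) :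
    IsSquareDeformed (fun i j => monomial 1 (b i j)) (fun i j => monomial 2 (c i j))
      (fun i j => monomial 2 (p i j)) where
  anti i j := by rw [← map_neg, ← hb.anti]
  comm i j k l h1 h2 h3 h4 h5 h6 := by
    rw [commute_iff_eq, monomial_mul_monomial, monomial_mul_monomial,
      (hb.comm i j k l h1 h2 h3 h4 h5 h6).eq]
  three i j k h1 h2 h3 := by
    rw [monomial_mul_monomial, monomial_mul_monomial, monomial_mul_monomial, ← map_add, ← map_add,
      hb.three i j k h1 h2 h3, map_zero]
  sq i j h := by rw [monomial_mul_monomial, hb.sq i j h, map_sub]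
  comm_c i j k l := by
    rw [commute_iff_eq, monomial_mul_monomial, monomial_mul_monomial, (hb.comm_c i j k l).eq]
  mul_p i j k l h := by rw [monomial_mul_monomial, monomial_mul_monomial, hb.mul_p i j k l h]

lemma defE_empty {ι A : Type*} [LinearOrder ι] [Ring A] [Algebra ℂ A]
    (c : ι → ι → ℂ) (X : ι → A) (k : ℕ) :
    defE c X k ∅ = if k = 0 then 1 else 0 := by
  match k with
  | 0 => simp [defE]
  | 1 => simp [defE]
  | k + 2 => simp [defE]

variable {ι A : Type*} [LinearOrder ι] [Fintype ι] [Ring A] [Algebra ℂ A]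

/-- Evaluation of the deformed elementary symmetric polynomials at the elements
`∑ j, b i j`. -/
theorem defE_eq_sum {b : ι → ι → A} {c : ι → ι → ℂ} {p : ι → ι → A}
    (hb : IsSquareDeformed b (fun i j => algebraMap ℂ A (c i j)) p)
    (hc : ∀ i j, c i j = c j i)
    (hX : ∀ i j, Commute (∑ k ∈ univ.erase i, b i k) (∑ k ∈ univ.erase j, b j k))
    {f : Finset ι → A} (hf0 : f ∅ = 1)
    (hf : ∀ U, ∀ j ∉ U, f (insert j U) = ∑ a ∈ U, f (U.erase a) * p a j) (k : ℕ) :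
    defE c (fun i => ∑ j ∈ univ.erase i, b i j) k univ = ∑ U ∈ powersetCard k univ, f U := by
  -- Placing f U in degree #U and using the generating series of the E_k for e, the coefficient of
  -- degree k selects exactly the subsets of size k.
  have key := sum_matchings_of_recursion (isSquareDeformed_monomial hb)
    (f := fun U => monomial U.card (f U))
    (e := fun I => PowerSeries.mk fun k => defE c (fun i => ∑ j ∈ univ.erase i, b i j) k I)
    (by simp [hf0]) ?_ ?_ ?_ ?_
  · have := congrArg (coeff k) key
    rw [coeff_mk] at this
    rw [this, map_sum, powersetCard_eq_filter, powerset_univ, sum_filter]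
    refine sum_congr rfl fun U _ => ?_
    rw [coeff_monomial]
    simp only [eq_comm]
  · intro U j hj
    rw [hf U j hj, map_sum]
    refine sum_congr rfl fun a ha => ?_
    rw [monomial_mul_monomial, card_insert_of_notMem hj, ← card_erase_add_one ha]
  · intro i j U
    rw [commute_iff_eq, monomial_mul_monomial, monomial_mul_monomial, Algebra.commutes, add_comm]
  · ext k
    rw [coeff_mk, defE_empty, coeff_one]
  · intro I j hj
    have hm : ∀ (m : ℕ) (x : A), (monomial m x : A⟦X⟧) = C x * X ^ m := fun m x => by
      ext k
      rw [coeff_C_mul, coeff_monomial, coeff_X_pow, mul_ite, mul_one, mul_zero]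
    rw [← map_sum, mul_add, mul_one, hm 1, pow_one, ← mul_assoc]
    -- The central variable is moved to the right, so that its two factors shift the coefficients to
    -- E_{k-2}; the cases k = 0, 1 are where these vanish.
    have hm' : ∀ i, (monomial 2 (algebraMap ℂ A (c i j)) * PowerSeries.mk fun k =>
        defE c (fun i => ∑ j ∈ univ.erase i, b i j) k (I.erase i)) =
        (C (algebraMap ℂ A (c i j)) * PowerSeries.mk fun k =>
          defE c (fun i => ∑ j ∈ univ.erase i, b i j) k (I.erase i)) * X * X := fun i => by
      rw [hm, mul_assoc, ← (commute_X_pow _ 2).eq, ← mul_assoc, pow_two, mul_assoc _ X X]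
    simp only [hm']
    ext k
    match k with
    | 0 => simp [defE]
    | 1 =>
      have h0 : ∀ I, defE c (fun i => ∑ j ∈ univ.erase i, b i j) 0 I = 1 := fun I => by
        rw [defE]
      have h1 := fun φ : A⟦X⟧ => coeff_succ_mul_X 0 φ
      rw [zero_add] at h1
      simp only [coeff_mk, map_add, map_sum, h1, coeff_zero_mul_X, sum_const_zero,
        defE_one, sum_insert hj, add_zero]
      rw [add_comm, ← map_sum, PowerSeries.coeff_mul_C, coeff_mk, h0, one_mul]
    | k + 2 =>
      simp only [coeff_mk, map_add, map_sum, coeff_succ_mul_X, coeff_C_mul]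
      rw [← map_sum, PowerSeries.coeff_mul_C, coeff_mk, defE_insert hc hX k I j hj]
      simp only [Algebra.smul_def]

end Graded

/-! ### Recursion for sums over perfect matchings -/

section Matchings

variable {n : ℕ}

lemma isPerfectMatching_empty (M : Finset (Fin n × Fin n)) :
    IsPerfectMatching ∅ M ↔ M = ∅ := by
  constructor
  · intro h
    exact eq_empty_of_forall_notMem fun p hp => notMem_empty _ (h.1 p hp).2.1
  · rintro rfl
    simp [IsPerfectMatching]

lemma IsPerfectMatching.insert_pair {U : Finset (Fin n)} {M : Finset (Fin n × Fin n)} {a j : Fin n}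
    (ha : a ∈ U) (hj : j ∉ U) (h : IsPerfectMatching (U.erase a) M) :
    IsPerfectMatching (insert j U) (insert (min a j, max a j) M) := by
  have haj := ne_of_mem_of_not_mem ha hj
  refine ⟨fun p hp => ?_, fun i hi => ?_⟩
  · rcases mem_insert.1 hp with rfl | hp
    · refine ⟨min_lt_max.2 haj, ?_, ?_⟩
      · rcases min_choice a j with h | h <;> simp [h, ha]
      · rcases max_choice a j with h | h <;> simp [h, ha]
    · have := h.1 p hp
      simp only [mem_erase] at this
      simp [this.1, this.2.1.2, this.2.2.2]
  · have hp : ∀ i, ((min a j, max a j) : Fin n × Fin n).1 = i ∨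
        ((min a j, max a j) : Fin n × Fin n).2 = i ↔ a = i ∨ j = i := by
      intro i
      rcases le_total a j with h | h
      · simp [h]
      · simp [h, or_comm]
    by_cases hi' : a = i ∨ j = i
    · refine ⟨_, ⟨mem_insert_self _ _, (hp i).2 hi'⟩, fun q ⟨hq, hqi⟩ => ?_⟩
      rcases mem_insert.1 hq with rfl | hq
      · rfl
      · have := h.1 q hq
        simp only [mem_erase] at this
        exfalso
        rcases hqi with rfl | rfl <;> rcases hi' with h' | h'
        · exact this.2.1.1 h'.symm
        · exact hj (h' ▸ this.2.1.2)
        · exact this.2.2.1 h'.symm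
        · exact hj (h' ▸ this.2.2.2)
    · have hiU : i ∈ U.erase a := by
        push Not at hi'
        exact mem_erase.2 ⟨hi'.1.symm, (mem_insert.1 hi).resolve_left hi'.2.symm⟩
      obtain ⟨q, ⟨hq, hqi⟩, hu⟩ := h.2 i hiU
      refine ⟨q, ⟨mem_insert_of_mem hq, hqi⟩, fun r ⟨hr, hri⟩ => ?_⟩
      rcases mem_insert.1 hr with rfl | hr
      · exact absurd ((hp i).1 hri) hi'
      · exact hu r ⟨hr, hri⟩

lemma IsPerfectMatching.erase_pair {U : Finset (Fin n)} {M : Finset (Fin n × Fin n)} {a j : Fin n}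
    (hj : j ∉ U) (h : IsPerfectMatching (insert j U) M)
    (haM : (min a j, max a j) ∈ M) :
    IsPerfectMatching (U.erase a) (M.erase (min a j, max a j)) := by
  have hp : ∀ i, ((min a j, max a j) : Fin n × Fin n).1 = i ∨
      ((min a j, max a j) : Fin n × Fin n).2 = i ↔ a = i ∨ j = i := by
    intro i
    rcases le_total a j with h | h
    · simp [h]
    · simp [h, or_comm]
  have key : ∀ q ∈ M.erase (min a j, max a j), ∀ i, (q.1 = i ∨ q.2 = i) → i ∈ insert j U →
      i ∈ U.erase a := by
    intro q hq i hqi hi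
    have hi' : ¬ (a = i ∨ j = i) := fun h' =>
      ne_of_mem_erase hq ((h.2 i hi).unique ⟨mem_of_mem_erase hq, hqi⟩ ⟨haM, (hp i).2 h'⟩)
    push Not at hi'
    exact mem_erase.2 ⟨hi'.1.symm, (mem_insert.1 hi).resolve_left hi'.2.symm⟩
  refine ⟨fun q hq => ?_, fun i hi => ?_⟩
  · have := h.1 q (mem_of_mem_erase hq)
    exact ⟨this.1, key q hq _ (Or.inl rfl) this.2.1, key q hq _ (Or.inr rfl) this.2.2⟩
  · obtain ⟨q, ⟨hq, hqi⟩, hu⟩ := h.2 i (mem_insert_of_mem (mem_of_mem_erase hi))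
    refine ⟨q, ⟨mem_erase.2 ⟨?_, hq⟩, hqi⟩, fun r hr => hu r ⟨mem_of_mem_erase hr.1, hr.2⟩⟩
    rintro rfl
    rcases (hp i).1 hqi with rfl | rfl
    · exact notMem_erase _ _ hi
    · exact hj (mem_of_mem_erase hi)

lemma IsPerfectMatching.exists_pair {U : Finset (Fin n)} {M : Finset (Fin n × Fin n)} {j : Fin n}
    (h : IsPerfectMatching (insert j U) M) : ∃ a ∈ U, (min a j, max a j) ∈ M := by
  obtain ⟨⟨x, y⟩, ⟨hq, hqi⟩, -⟩ := h.2 j (mem_insert_self j U)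
  obtain ⟨hlt, hx, hy⟩ := h.1 _ hq
  dsimp only at hqi hlt hx hy
  rcases hqi with rfl | rfl
  · exact ⟨y, (mem_insert.1 hy).resolve_left hlt.ne', by
      rwa [min_eq_right hlt.le, max_eq_left hlt.le]⟩
  · exact ⟨x, (mem_insert.1 hx).resolve_left hlt.ne, by
      rwa [min_eq_left hlt.le, max_eq_right hlt.le]⟩

lemma matchSum_empty (L : PeriodPair) : matchSum L (∅ : Finset (Fin n)) = 1 := by
  classical
  rw [matchSum, sum_eq_single ∅]
  · simp
  · intro M hM h
    exact absurd ((isPerfectMatching_empty M).1 (mem_filter.1 hM).2) h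
  · intro h
    exact absurd (mem_filter.2 ⟨mem_univ _, (isPerfectMatching_empty ∅).2 rfl⟩) h

lemma ofDiff_wp_symm (L : PeriodPair) (i j : Fin n) : ofDiff (wp L) i j = ofDiff (wp L) j i := by
  refine (Mero.mk_eq_mk_iff _ _).2 (Filter.Eventually.of_forall fun x => ?_)
  change L.weierstrassP (x i - x j) = L.weierstrassP (x j - x i)
  rw [← neg_sub, L.weierstrassP_neg]

/-- Perfect matchings of U ∪ {j} are classified by the partner a of j. Pairs are stored in
increasing order, hence the minima and maxima; evenness of ℘ makes the order irrelevant in the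
product. -/
lemma matchSum_insert (L : PeriodPair) {U : Finset (Fin n)} {j : Fin n} (hj : j ∉ U) :
    matchSum L (insert j U) = ∑ a ∈ U, matchSum L (U.erase a) * ofDiff (wp L) a j := by
  classical
  have notMem : ∀ a ∈ U, ∀ M, IsPerfectMatching (U.erase a) M → (min a j, max a j) ∉ M := by
    intro a ha M hM h
    have := hM.1 _ h
    rcases le_total a j with h' | h'
    · rw [min_eq_left h'] at this
      exact notMem_erase _ _ this.2.1
    · rw [max_eq_left h'] at this
      exact notMem_erase _ _ this.2.2
  have hw : ∀ a, ofDiff (wp L) a j = ofDiff (wp L) (min a j) (max a j) := by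
    intro a
    rcases le_total a j with h | h
    · rw [min_eq_left h, max_eq_right h]
    · rw [min_eq_right h, max_eq_left h, ofDiff_wp_symm]
  simp only [matchSum, sum_mul]
  rw [sum_sigma']
  symm
  refine sum_bij (fun x _ => insert (min x.1 j, max x.1 j) x.2) ?_ ?_ ?_ ?_
  · rintro ⟨a, M⟩ h
    simp only [mem_sigma, mem_filter, mem_univ, true_and] at h ⊢
    exact h.2.insert_pair h.1 hj
  · rintro ⟨a, M⟩ h ⟨a', M'⟩ h' heq
    simp only [mem_sigma, mem_filter, mem_univ, true_and] at h h' heq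
    have hPM := h.2.insert_pair h.1 hj
    have hp : ∀ a : Fin n, ((min a j, max a j) : Fin n × Fin n).1 = j ∨
        ((min a j, max a j) : Fin n × Fin n).2 = j := by
      intro a
      rcases le_total a j with h | h
      · simp [h]
      · simp [h]
    have e := (hPM.2 j (mem_insert_self j U)).unique ⟨mem_insert_self _ _, hp a⟩
      ⟨heq ▸ mem_insert_self _ _, hp a'⟩
    have haa : a = a' := by
      have h1 := ne_of_mem_of_not_mem h.1 hj
      have h2 := ne_of_mem_of_not_mem h'.1 hj
      rw [Prod.mk.injEq] at e
      rcases le_total a j with h3 | h3 <;> rcases le_total a' j with h4 | h4 <;>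
        simp only [h3, h4, min_eq_left, min_eq_right, max_eq_left, max_eq_right] at e
      · exact e.1
      · exact absurd e.1 h1
      · exact absurd e.1.symm h2
      · exact e.2
    subst haa
    rw [← erase_insert (notMem a h.1 M h.2), heq, erase_insert (notMem a h'.1 M' h'.2)]
  · intro M hM
    simp only [mem_filter, mem_univ, true_and] at hM
    obtain ⟨a, ha, haM⟩ := hM.exists_pair
    exact ⟨⟨a, M.erase (min a j, max a j)⟩, by
      simpa only [mem_sigma, mem_filter, mem_univ, true_and] using
        ⟨ha, hM.erase_pair hj haM⟩, insert_erase haM⟩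
  · rintro ⟨a, M⟩ h
    simp only [mem_sigma, mem_filter, mem_univ, true_and] at h
    rw [prod_insert (notMem a h.1 M h.2), hw, mul_comm]

lemma matchSum_eq_zero_of_odd (L : PeriodPair) {U : Finset (Fin n)} (hU : Odd U.card) :
    matchSum L U = 0 := by
  induction hN : U.card using Nat.strong_induction_on generalizing U with
  | _ N ih =>
  subst hN
  obtain ⟨j, hjU⟩ : U.Nonempty := card_pos.1 hU.pos
  rw [← insert_erase hjU, matchSum_insert L (notMem_erase j U)]
  refine sum_eq_zero fun a ha => ?_
  have h1 := card_erase_add_one hjU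
  have h2 := card_erase_add_one ha
  rw [← h1, ← h2, add_assoc] at hU
  rw [ih _ (by omega) ((Nat.odd_add.1 hU).2 (by decide)) rfl, zero_mul]

end Matchings

/-! ### The elliptic brackets -/

section Elliptic

variable {n : ℕ}

/-- By `bracket_square`, b i j ^ 2 is ψ_ij(x_ij) - a²/x_ij², which is ℘(λ_ij) - ℘(x_ij). The
constant is central and crossing permutes the arguments of ℘. -/
lemma bracket_isSquareDeformed (L : PeriodPair) (lam : Fin n → ℂ) (a : ℂ) :
    IsSquareDeformed (bracket (ratPhi n a) (ellPsi L lam a))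
      (fun i j => algebraMap ℂ _ (L.weierstrassP (lam i - lam j)))
      (fun i j => scalar (ratPhi n a) (ellPsi L lam a) (ofDiff (wp L) i j)) where
  anti := bracket_antisymm a _
  comm i j k l := bracket_comm a _
  three i j k := bracket_threeTerm a _
  sq i j h := by
    rw [bracket_square a _ h, ratFn, ← map_mul, ← map_sub,
      ← (scalar (ratPhi n a) (ellPsi L lam a)).commutes, ← map_sub]
    congr 1
    have e : ofDiff (ellPsi L lam a i j) i j + ofDiff (wp L) i j =
        algebraMap ℂ _ (L.weierstrassP (lam i - lam j)) +
          ofDiff (ratPhi n a i j) i j * ofDiff (ratPhi n a i j) i j := by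
      have m := isMero_diff (ratPhi n a i j).2 i j
      refine (Mero.mk_eq_mk_iff
        ((isMero_diff (ellPsi L lam a i j).2 i j).add (isMero_diff (wp L).2 i j))
        ((isMero_const _).add (m.mul m))).2 (Filter.Eventually.of_forall fun x => ?_)
      change a ^ 2 / (x i - x j) ^ 2 -
          (L.weierstrassP (x i - x j) - L.weierstrassP (lam i - lam j)) +
          L.weierstrassP (x i - x j) =
        L.weierstrassP (lam i - lam j) + a / (x i - x j) * (a / (x i - x j))
      rw [div_mul_div_comm, ← pow_two, ← pow_two]
      ring
    rw [sub_eq_sub_iff_add_eq_add, e]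
  comm_c _ _ _ _ := Algebra.commutes _ _
  mul_p i j k l h := by rw [bracket_mul_scalar _ _ h, comp_ofDiff]

end Elliptic

end EllipticFK

theorem corollary3p2 (n : ℕ) (L : PeriodPair) (lam : Fin n → ℂ)
    (hlam : ∀ i j, i ≠ j → lam i - lam j ∉ L.lattice) (a : ℂ) (k : ℕ) :
    EllipticFK.defE (fun i j => L.weierstrassP (lam i - lam j))
        (EllipticFK.dunkl (EllipticFK.ratPhi n a) (EllipticFK.ellPsi L lam a)) k Finset.univ =
      if Even k then
        EllipticFK.scalar (EllipticFK.ratPhi n a) (EllipticFK.ellPsi L lam a)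
          (∑ I₀ ∈ Finset.powersetCard k Finset.univ, EllipticFK.matchSum L I₀)
      else 0 := by
  have key := EllipticFK.defE_eq_sum (EllipticFK.bracket_isSquareDeformed L lam a)
    (fun i j => by rw [← neg_sub, L.weierstrassP_neg]) (EllipticFK.dunkl_commute a _)
    (f := fun U => EllipticFK.scalar (EllipticFK.ratPhi n a) (EllipticFK.ellPsi L lam a)
      (EllipticFK.matchSum L U))
    (by rw [EllipticFK.matchSum_empty, map_one])
    (fun U j hj => by simp only [EllipticFK.matchSum_insert L hj, map_sum, map_mul]) k
  refine key.trans ?_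
  split_ifs with hk
  · rw [map_sum]
  · refine Finset.sum_eq_zero fun U hU => ?_
    rw [EllipticFK.matchSum_eq_zero_of_odd L, map_zero]
    rw [(Finset.mem_powersetCard.1 hU).2]
    exact Nat.not_even_iff_odd.1 hk
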